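/- Let $n\ge 1$ and let $K\subset\mathbb R^n$ be a convex body (a compact convex set with non-empty interior) with $0$ in its interior. Let $\|x\|_K=\min\{\alpha\ge 0: x\in\alpha K\}$ be its gauge function and let $\psi(x)=\|x\|_K^2/2$. For a convex function $\psi:\mathbb R^n\to\mathbb R$ put $$\operatorname{as}(\psi)=\int_{\mathbb R^n}\bigl(\det\nabla^2\psi(x)\bigr)^{\frac1{n+2}}e^{-\psi(x)}\,dx,$$ where $\nabla^2\psi(x)$ is the generalized (Alexandrov) Hessian, i.e. the symmetric linear map with $\psi(x+y)=\psi(x)+\langle\nabla\psi(x),y\rangle+\frac12\langle\nabla^2\psi(x)y,y\rangle+o(\|y\|^2)$ as $y\to0$, which exists for almost every $x$. For real $p\ne -n$ put $$\operatorname{as}_p(K)=\int_{\partial K}\frac{\kappa_K(z)^{\frac p{n+p}}}{\langle z,N_K(z)\rangle^{\frac{n(p-1)}{n+p}}}\,d\mu_K(z),$$ where $\mu_K$ is the surface area measure (the $(n-1)$-dimensional Hausdorff measure on $\partial K$), $N_K(z)$ is the outer unit normal and $\kappa_K(z)$ is the generalized Gauss curvature of $\partial K$ at $z$, i.e. the determinant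 of the generalized Hessian at $0$ of the function whose graph over the tangent hyperplane at $z$ is $\partial K$ near $z$ (so $\kappa_K=1$ if $n=1$); both exist for $\mu_K$-almost every $z$. Then the integrals defining $\operatorname{as}(\psi)$ and $\operatorname{as}_{n/(n+1)}(K)$ are finite, and $$\operatorname{as}\!\left(\frac{\|\cdot\|_K^2}{2}\right)=\frac{(2\pi)^{n/2}}{n\,\operatorname{vol}_n(B_2^n)}\;\operatorname{as}_{\frac n{n+1}}(K),$$ where $B_2^n$ is the closed Euclidean unit ball. -/

import Mathlib

open MeasureTheory Set Filter Topology Asymptotics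
open scoped RealInnerProductSpace

noncomputable section

/-- `A` is the generalized (Alexandrov) Hessian of `f` at `x`: a symmetric linear map with
`f (x + y) = f x + ⟪∇ f x, y⟫ + (1/2) ⟪A y, y⟫ + o(‖y‖ ^ 2)` as `y → 0`.
Such an `A` is unique if it exists. -/
def HasGeneralizedHessianAt {V : Type*} [NormedAddCommGroup V] [InnerProductSpace ℝ V]
    [CompleteSpace V] (f : V → ℝ) (A : V →ₗ[ℝ] V) (x : V) : Prop :=
  A.IsSymmetric ∧
    (fun y : V => f (x + y) - f x - ⟪gradient f x, y⟫ - (1 / 2) * ⟪A y, y⟫)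
      =o[𝓝 0] fun y : V => ‖y‖ ^ 2

open Classical in
/-- The generalized Hessian `∇² f x`, set to `0` at the points where it does not exist. -/
def generalizedHessian {V : Type*} [NormedAddCommGroup V] [InnerProductSpace ℝ V]
    [CompleteSpace V] (f : V → ℝ) (x : V) : V →ₗ[ℝ] V :=
  if h : ∃ A : V →ₗ[ℝ] V, HasGeneralizedHessianAt f A x then h.choose else 0

/-- The integrand `(det ∇² ψ x) ^ (1 / (n + 2)) * exp (- ψ x)`. -/
def affineSurfaceDensity {n : ℕ} (ψ : EuclideanSpace ℝ (Fin n) → ℝ)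
    (x : EuclideanSpace ℝ (Fin n)) : ℝ :=
  LinearMap.det (generalizedHessian ψ x) ^ (1 / ((n : ℝ) + 2)) * Real.exp (-ψ x)

/-- The affine surface area `as(ψ)` of a convex function `ψ` on `ℝⁿ`
(that is, of the log-concave function `exp (-ψ)`). -/
def affineSurfaceArea {n : ℕ} (ψ : EuclideanSpace ℝ (Fin n) → ℝ) : ℝ :=
  ∫ x, affineSurfaceDensity ψ x

/-- `N` is an outer unit normal of `K` at `z`. -/
def IsOuterUnitNormal {n : ℕ} (K : Set (EuclideanSpace ℝ (Fin n)))
    (z N : EuclideanSpace ℝ (Fin n)) : Prop :=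
  ‖N‖ = 1 ∧ ∀ x ∈ K, ⟪x - z, N⟫ ≤ 0

open Classical in
/-- The outer unit normal `N_K(z)`, set to `0` at the points where it is not unique. -/
def outerUnitNormal {n : ℕ} (K : Set (EuclideanSpace ℝ (Fin n)))
    (z : EuclideanSpace ℝ (Fin n)) : EuclideanSpace ℝ (Fin n) :=
  if h : ∃! N, IsOuterUnitNormal K z N then h.choose else 0

/-- The boundary of `K` near `z` as a graph over the tangent hyperplane `N_K(z)ᗮ`:
`localGraph K z y` is the depth below `z + y`, in the direction of the inner normal, at which `K`
starts. Near `y = 0` this is a nonnegative convex function that vanishes at `0`. -/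
def localGraph {n : ℕ} (K : Set (EuclideanSpace ℝ (Fin n))) (z : EuclideanSpace ℝ (Fin n))
    (y : (Submodule.span ℝ {outerUnitNormal K z})ᗮ) : ℝ :=
  sInf {t : ℝ | z + (y : EuclideanSpace ℝ (Fin n)) - t • outerUnitNormal K z ∈ K}

open Classical in
/-- The (generalized) Gauss curvature `κ_K(z)`: the determinant of the generalized Hessian at `0`
of the local graph function of the boundary over the tangent hyperplane. It is `1` in
dimension `n = 1` (an empty determinant), and set to `0` where there is no unique normal. -/
def gaussCurvature {n : ℕ} (K : Set (EuclideanSpace ℝ (Fin n)))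
    (z : EuclideanSpace ℝ (Fin n)) : ℝ :=
  if ∃! N, IsOuterUnitNormal K z N then LinearMap.det (generalizedHessian (localGraph K z) 0)
  else 0

/-- The surface area measure `μ_K`: the `(n - 1)`-dimensional Hausdorff measure (normalized
to agree with Lebesgue measure on `ℝⁿ⁻¹`) restricted to the boundary of `K`, for `n ≥ 1`. -/
def surfaceAreaMeasure {n : ℕ} (K : Set (EuclideanSpace ℝ (Fin n))) :
    Measure (EuclideanSpace ℝ (Fin n)) :=
  (Measure.euclideanHausdorffMeasure (n - 1)).restrict (frontier K)

/-- The integrand `κ_K(z) ^ (p / (n + p)) / ⟪z, N_K(z)⟫ ^ (n (p - 1) / (n + p))`. -/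
def lpAffineSurfaceDensity {n : ℕ} (p : ℝ) (K : Set (EuclideanSpace ℝ (Fin n)))
    (z : EuclideanSpace ℝ (Fin n)) : ℝ :=
  gaussCurvature K z ^ (p / (n + p)) /
    ⟪z, outerUnitNormal K z⟫ ^ ((n : ℝ) * (p - 1) / (n + p))

/-- The `L_p` affine surface area `as_p(K)`, for real `p ≠ -n`. -/
def lpAffineSurfaceArea {n : ℕ} (p : ℝ) (K : Set (EuclideanSpace ℝ (Fin n))) : ℝ :=
  ∫ z, lpAffineSurfaceDensity p K z ∂(surfaceAreaMeasure K)

end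

/-!
Let `g = gauge K` and `ψ = g ^ 2 / 2`, and let `h(z) = ⟪z, N_K(z)⟫` be the distance from the origin
to the tangent hyperplane of `K` at `z`. With `p = n / (n + 1)` the integrand of `as_p(K)` is
`(κ_K h) ^ (1 / (n + 2))`. The theorem is integration in polar coordinates adapted to `K`, combined
with the pointwise identity `κ_K(z) = h(z) ^ (n + 1) * det ∇²ψ(z)`.

*Polar coordinates.* The density `det ∇²ψ ^ (1 / (n + 2))` is homogeneous of degree `0`, so the
layer cake formula reduces its integral against `exp (-ψ)` to its integral over `{g < 1}`
(`lintegral_mul_exp_neg_gauge_sq`); the constant depends on the dimension only and is read off from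
the Gaussian integral and the Euclidean ball (`lintegral_gaussian_const`). The radial projection
turns the integral over `{g < 1}` into one against the cone measure on the boundary, and the cone
measure is `h` times the surface area measure (`coneMeasure_eq_withDensity`). This last fact takes
the place of an area formula: a convex function is strictly differentiable wherever it is
differentiable (`ConvexOn.hasStrictFDerivAt`), hence near a boundary point with a tangent hyperplane
the radial projection of that hyperplane onto the boundary is nearly isometric, and on the
hyperplane itself the two measures agree (`volume_hyperplaneCone`). So the two measures on the
boundary are locally comparable with constants arbitrarily close to `1`. The boundary points without
tangent hyperplane are negligible by Rademacher's theorem.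

*Curvature.* On the tangent hyperplane at `z`, the function `ψ(z + ·) - 1 / 2` is asymptotic to the
local graph function divided by `h(z)` (`isEquivalent_gauge_sq_localGraph`), again by strict
differentiability. Hence one of them has a second order expansion if and only if the other does, and
the homogeneity of `ψ` extends the expansion to the whole space. Existence of the generalized
Hessians being equivalent pointwise, with both determinants `0` by convention where they do not
exist, the identity `gaussCurvature_eq` holds wherever `g` is differentiable, and Alexandrov's
theorem is not needed.

*Measurability and finiteness.* The generalized Hessian is a measurable function of the point,
being determined by limits of second differences (`measurable_det_generalizedHessian`). Its
determinant to the power `1 / (n + 2)` is at most one plus its trace, and the trace is locally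
integrable by Fatou's lemma and a summation by parts for second differences
(`lintegral_det_generalizedHessian_lt_top`).
-/

/-! ### Differentiability of convex functions -/

section ConvexCalculus

variable {V : Type*} [NormedAddCommGroup V] [NormedSpace ℝ V]

/-- A convex function is strictly differentiable wherever it is differentiable: the remainder of
the first order expansion is convex, hence its local Lipschitz constant is controlled by its
size. -/
theorem ConvexOn.hasStrictFDerivAt {f : V → ℝ} (hf : ConvexOn ℝ univ f) {f' : V →L[ℝ] ℝ} {z : V}
    (h : HasFDerivAt f f' z) : HasStrictFDerivAt f f' z := by
  refine HasStrictFDerivAt.of_isLittleO ?_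
  rw [isLittleO_iff]
  intro c hc
  have h1 := h.isLittleO
  rw [isLittleO_iff] at h1
  obtain ⟨r, hr, hball⟩ := Metric.eventually_nhds_iff_ball.1 (h1 (show 0 < c / 4 by positivity))
  set k : V → ℝ := fun y => f y - f z - f' (y - z) with hk
  have hconv : ConvexOn ℝ univ k := by
    refine ⟨convex_univ, fun x _ y _ a b ha hb hab => ?_⟩
    have := hf.2 (mem_univ x) (mem_univ y) ha hb hab
    simp only [smul_eq_mul] at this
    have e : a • x + b • y - z = a • (x - z) + b • (y - z) := by
      have : z = (a + b) • z := by rw [hab, one_smul]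
      nth_rewrite 1 [this]
      module
    have e2 : f z = a * f z + b * f z := by rw [← add_mul, hab, one_mul]
    simp only [hk, e, map_add, map_smul, smul_eq_mul]
    linarith
  have hlip := (hconv.subset (subset_univ (Metric.ball z r))
    (convex_ball z r)).lipschitzOnWith_of_abs_le
    (ε := r / 2) (M := c / 4 * r) (by positivity) (fun a ha => by
      have := hball a ha
      rw [Real.norm_eq_abs] at this
      refine this.trans ?_
      rw [← dist_eq_norm]
      gcongr)
  have hmem : Metric.ball (z, z) (r - r / 2) ∈ 𝓝 ((z, z) : V × V) :=
    Metric.ball_mem_nhds _ (by linarith)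
  filter_upwards [hmem] with p hp
  rw [← ball_prod_same] at hp
  have := hlip.dist_le_mul p.1 hp.1 p.2 hp.2
  rw [Real.coe_toNNReal _ (by positivity), Real.dist_eq, dist_eq_norm] at this
  have e : k p.1 - k p.2 = f p.1 - f p.2 - f' (p.1 - p.2) := by
    simp only [hk, map_sub]; ring
  rw [e] at this
  rw [Real.norm_eq_abs]
  refine this.trans_eq ?_
  field_simp
  norm_num

/-- The gradient inequality for convex functions. -/
theorem ConvexOn.add_fderiv_le {f : V → ℝ} (hf : ConvexOn ℝ univ f) {f' : V →L[ℝ] ℝ} {z : V}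
    (h : HasFDerivAt f f' z) (v : V) : f z + f' v ≤ f (z + v) := by
  have h1 : HasDerivAt (fun t : ℝ => f (z + t • v)) (f' v) 0 := by
    have h2 : HasFDerivAt f f' (z + (0 : ℝ) • v) := by simpa using h
    have h3 : HasDerivAt (fun t : ℝ => z + t • v) v 0 := by
      simpa using ((hasDerivAt_id (0 : ℝ)).smul_const v).const_add z
    exact h2.comp_hasDerivAt 0 h3
  have h4 := h1.tendsto_slope_zero_right
  have : f' v ≤ f (z + v) - f z := by
    refine le_of_tendsto h4 ?_
    filter_upwards [Ioc_mem_nhdsGT (zero_lt_one' ℝ)] with t ht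
    have := hf.2 (mem_univ z) (mem_univ (z + v)) (by linarith [ht.2] : 0 ≤ 1 - t) ht.1.le (by ring)
    have e : (1 - t) • z + t • (z + v) = z + t • v := by module
    rw [e] at this
    simp only [smul_eq_mul, zero_add, zero_smul, add_zero] at this ⊢
    rw [inv_mul_le_iff₀ ht.1]
    linarith
  linarith

end ConvexCalculus

/-! ### The gauge function and the radial projection -/

section Gauge

variable {V : Type*} [NormedAddCommGroup V] [NormedSpace ℝ V] {K : Set V}

theorem gauge_smul_nonneg {r : ℝ} (hr : 0 ≤ r) (x : V) : gauge K (r • x) = r * gauge K x := by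
  rw [gauge_smul_of_nonneg hr, smul_eq_mul]

theorem convexOn_gauge (hc : Convex ℝ K) (h0 : K ∈ 𝓝 0) : ConvexOn ℝ univ (gauge K) := by
  refine ⟨convex_univ, fun x _ y _ a b ha hb _ => ?_⟩
  refine (gauge_add_le hc (absorbent_nhds_zero h0) _ _).trans ?_
  rw [gauge_smul_nonneg ha, gauge_smul_nonneg hb, smul_eq_mul, smul_eq_mul]

theorem convexOn_gauge_sq (hc : Convex ℝ K) (h0 : K ∈ 𝓝 0) :
    ConvexOn ℝ univ (fun x => gauge K x ^ 2 / 2) := by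
  have := ((convexOn_gauge hc h0).pow (fun x _ => gauge_nonneg x) 2).smul
    (show (0 : ℝ) ≤ 1 / 2 by norm_num)
  convert! this using 2 with x
  simp; ring

theorem gauge_pos_of_ne (h0 : K ∈ 𝓝 0) (hb : Bornology.IsBounded K) {x : V} (hx : x ≠ 0) :
    0 < gauge K x :=
  (gauge_pos (absorbent_nhds_zero h0) (NormedSpace.isVonNBounded_of_isBounded ℝ hb)).2 hx

/-- Euler's relation for the positively homogeneous function `gauge K`. -/
theorem fderiv_gauge_self {g' : V →L[ℝ] ℝ} {z : V} (h : HasFDerivAt (gauge K) g' z) :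
    g' z = gauge K z := by
  have h1 : HasDerivAt (fun t : ℝ => gauge K (t • z)) (g' z) 1 := by
    have h2 : HasFDerivAt (gauge K) g' ((1 : ℝ) • z) := by simpa using h
    have h3 : HasDerivAt (fun t : ℝ => t • z) z 1 := by
      simpa using ((hasDerivAt_id (1 : ℝ)).smul_const z)
    exact h2.comp_hasDerivAt 1 h3
  have h4 : HasDerivAt (fun t : ℝ => gauge K (t • z)) (gauge K z) 1 := by
    have : HasDerivAt (fun t : ℝ => t * gauge K z) (gauge K z) 1 := by
      simpa using (hasDerivAt_id (1 : ℝ)).mul_const (gauge K z)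
    refine this.congr_of_eventuallyEq ?_
    filter_upwards [lt_mem_nhds (zero_lt_one' ℝ)] with t ht
    exact gauge_smul_nonneg ht.le z
  exact h1.unique h4

theorem ne_zero_of_gauge_eq_one {z : V} (hz : gauge K z = 1) : z ≠ 0 := by
  rintro rfl; simp at hz

/-- The radial projection onto the boundary of `K`. -/
noncomputable def radialProj (K : Set V) (x : V) : V := (gauge K x)⁻¹ • x

theorem radialProj_smul {r : ℝ} (hr : 0 < r) (x : V) : radialProj K (r • x) = radialProj K x := by
  rw [radialProj, radialProj, gauge_smul_nonneg hr.le, smul_smul, mul_inv, mul_right_comm,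
    inv_mul_cancel₀ hr.ne', one_mul]

theorem radialProj_eq_self {x : V} (hx : gauge K x = 1) : radialProj K x = x := by
  simp [radialProj, hx]

theorem gauge_radialProj (h0 : K ∈ 𝓝 0) (hb : Bornology.IsBounded K) {x : V} (hx : x ≠ 0) :
    gauge K (radialProj K x) = 1 := by
  have := gauge_pos_of_ne h0 hb hx
  rw [radialProj, gauge_smul_nonneg (inv_nonneg.2 this.le), inv_mul_cancel₀ this.ne']

theorem hasFDerivAt_gauge_smul {g' : V →L[ℝ] ℝ} {z : V} (h : HasFDerivAt (gauge K) g' z)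
    {r : ℝ} (hr : 0 < r) : HasFDerivAt (gauge K) g' (r • z) := by
  have h1 : HasFDerivAt (gauge K) g' (r⁻¹ • (r • z)) := by
    rwa [inv_smul_smul₀ hr.ne']
  have h2 : HasFDerivAt (fun x : V => r⁻¹ • x) (r⁻¹ • ContinuousLinearMap.id ℝ V) (r • z) :=
    ((ContinuousLinearMap.id ℝ V).hasFDerivAt (x := r • z)).const_smul r⁻¹
  have h3 := (h1.comp (r • z) h2).const_mul r
  have e : (fun x => r * (gauge K ∘ fun x : V => r⁻¹ • x) x) = gauge K := by
    ext x
    simp only [Function.comp]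
    rw [gauge_smul_nonneg (inv_nonneg.2 hr.le), mul_inv_cancel_left₀ hr.ne']
  rw [e] at h3
  convert! h3 using 1
  ext v
  simp [hr.ne']

theorem differentiableAt_gauge_smul_iff {r : ℝ} (hr : 0 < r) (z : V) :
    DifferentiableAt ℝ (gauge K) (r • z) ↔ DifferentiableAt ℝ (gauge K) z := by
  refine ⟨fun h' => ?_, fun h => (hasFDerivAt_gauge_smul h.hasFDerivAt hr).differentiableAt⟩
  have := (hasFDerivAt_gauge_smul h'.hasFDerivAt (inv_pos.2 hr)).differentiableAt
  rwa [inv_smul_smul₀ hr.ne'] at this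

end Gauge

/-! ### Outer unit normals -/

section Normal

variable {n : ℕ} {K : Set (EuclideanSpace ℝ (Fin n))} {z : EuclideanSpace ℝ (Fin n)}

theorem inner_gradient_eq_fderiv {V : Type*} [NormedAddCommGroup V] [InnerProductSpace ℝ V]
    [CompleteSpace V] (f : V → ℝ) (x v : V) : ⟪gradient f x, v⟫ = fderiv ℝ f x v := by
  rw [gradient, InnerProductSpace.toDual_symm_apply]

theorem inner_gradient_gauge_self (h : DifferentiableAt ℝ (gauge K) z) (hz : gauge K z = 1) :
    ⟪gradient (gauge K) z, z⟫ = 1 := by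
  rw [inner_gradient_eq_fderiv, fderiv_gauge_self h.hasFDerivAt, hz]

theorem gradient_gauge_ne_zero (h : DifferentiableAt ℝ (gauge K) z) (hz : gauge K z = 1) :
    gradient (gauge K) z ≠ 0 := by
  intro h'
  have := inner_gradient_gauge_self h hz
  simp [h'] at this

/-- At a boundary point where the gauge is differentiable, the normalized gradient is the only
outer unit normal. -/
theorem isOuterUnitNormal_iff_of_differentiableAt (hc : Convex ℝ K) (h0 : K ∈ 𝓝 0)
    (hcl : IsClosed K)
    (h : DifferentiableAt ℝ (gauge K) z) (hz : gauge K z = 1) (N : EuclideanSpace ℝ (Fin n)) :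
    IsOuterUnitNormal K z N ↔
      N = ‖gradient (gauge K) z‖⁻¹ • gradient (gauge K) z := by
  have hne := gradient_gauge_ne_zero h hz
  have hpos : 0 < ‖gradient (gauge K) z‖ := norm_pos_iff.2 hne
  constructor
  · rintro ⟨hN, hNK⟩
    have key : ∀ v, ⟪v, N⟫ = fderiv ℝ (gauge K) z v * ⟪z, N⟫ := by
      intro v
      -- `z + t • v - gauge K (z + t • v) • z` pairs nonpositively with `N`, with equality at `t = 0`
      have hloc : IsLocalMax (fun t : ℝ => ⟪z + t • v, N⟫ - gauge K (z + t • v) * ⟪z, N⟫) 0 := by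
        have hcont : Continuous fun t : ℝ => gauge K (z + t • v) :=
          (continuous_gauge hc h0).comp (by fun_prop)
        have hp : ∀ᶠ t : ℝ in 𝓝 0, 0 < gauge K (z + t • v) := by
          refine hcont.continuousAt.eventually_const_lt ?_
          simp [hz]
        filter_upwards [hp] with t ht
        have hmem : (gauge K (z + t • v))⁻¹ • (z + t • v) ∈ K := by
          have : (gauge K (z + t • v))⁻¹ • (z + t • v) ∈ closure K := by
            rw [← gauge_le_one_iff_mem_closure hc h0,
              gauge_smul_nonneg (inv_nonneg.2 ht.le), inv_mul_cancel₀ ht.ne']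
          rwa [hcl.closure_eq] at this
        have := hNK _ hmem
        rw [inner_sub_left, real_inner_smul_left] at this
        simp only [zero_smul, add_zero, hz, one_mul, sub_self]
        rw [sub_nonpos, inv_mul_le_iff₀ ht] at this
        linarith
      have hd : HasDerivAt (fun t : ℝ => ⟪z + t • v, N⟫ - gauge K (z + t • v) * ⟪z, N⟫)
          (⟪v, N⟫ - fderiv ℝ (gauge K) z v * ⟪z, N⟫) 0 := by
        have h3 : HasDerivAt (fun t : ℝ => z + t • v) v 0 := by
          simpa using ((hasDerivAt_id (0 : ℝ)).smul_const v).const_add z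
        have h2 : HasFDerivAt (gauge K) (fderiv ℝ (gauge K) z) (z + (0 : ℝ) • v) := by
          simpa using h.hasFDerivAt
        refine HasDerivAt.sub ?_ ((h2.comp_hasDerivAt 0 h3).mul_const _)
        simpa using h3.inner ℝ (hasDerivAt_const (0 : ℝ) N)
      have := hloc.hasDerivAt_eq_zero hd
      linarith
    have hNeq : N = ⟪z, N⟫ • gradient (gauge K) z := by
      refine ext_inner_right ℝ fun v => ?_
      rw [inner_smul_left, inner_gradient_eq_fderiv, real_inner_comm, key v]
      simp [mul_comm]
    have hnn : 0 ≤ ⟪z, N⟫ := by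
      have := hNK 0 (mem_of_mem_nhds h0)
      rw [zero_sub, inner_neg_left] at this
      linarith
    have hnorm : ⟪z, N⟫ * ‖gradient (gauge K) z‖ = 1 := by
      rw [← hN]
      conv_rhs => rw [hNeq, norm_smul, Real.norm_of_nonneg hnn]
    rw [hNeq]
    congr 1
    exact eq_inv_of_mul_eq_one_left hnorm
  · rintro rfl
    refine ⟨by rw [norm_smul, norm_inv, norm_norm, inv_mul_cancel₀ hpos.ne'], fun x hx => ?_⟩
    rw [inner_smul_right, real_inner_comm, inner_gradient_eq_fderiv]
    refine mul_nonpos_of_nonneg_of_nonpos (by positivity) ?_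
    have := (convexOn_gauge hc h0).add_fderiv_le h.hasFDerivAt (x - z)
    rw [add_sub_cancel, hz] at this
    linarith [gauge_le_one_of_mem hx]

theorem existsUnique_isOuterUnitNormal (hc : Convex ℝ K) (h0 : K ∈ 𝓝 0)
    (hcl : IsClosed K)
    (h : DifferentiableAt ℝ (gauge K) z) (hz : gauge K z = 1) :
    ∃! N, IsOuterUnitNormal K z N :=
  ⟨_, (isOuterUnitNormal_iff_of_differentiableAt hc h0 hcl h hz _).2 rfl,
    fun _ hN => (isOuterUnitNormal_iff_of_differentiableAt hc h0 hcl h hz _).1 hN⟩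

theorem outerUnitNormal_eq (hc : Convex ℝ K) (h0 : K ∈ 𝓝 0)
    (hcl : IsClosed K)
    (h : DifferentiableAt ℝ (gauge K) z) (hz : gauge K z = 1) :
    outerUnitNormal K z = ‖gradient (gauge K) z‖⁻¹ • gradient (gauge K) z := by
  have hex := existsUnique_isOuterUnitNormal hc h0 hcl h hz
  rw [outerUnitNormal, dif_pos hex]
  exact (isOuterUnitNormal_iff_of_differentiableAt hc h0 hcl h hz _).1 hex.choose_spec.1

theorem inner_outerUnitNormal (hc : Convex ℝ K) (h0 : K ∈ 𝓝 0)
    (hcl : IsClosed K)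
    (h : DifferentiableAt ℝ (gauge K) z) (hz : gauge K z = 1) :
    ⟪z, outerUnitNormal K z⟫ = ‖gradient (gauge K) z‖⁻¹ := by
  rw [outerUnitNormal_eq hc h0 hcl h hz, inner_smul_right, real_inner_comm,
    inner_gradient_gauge_self h hz, mul_one]

end Normal

/-! ### Cones over subsets of a hyperplane -/

section Hyperplane

open scoped Pointwise NNReal ENNReal

theorem LipschitzOnWith.euclideanHausdorffMeasure_image_le {X Y : Type*} [MetricSpace X]
    [MetricSpace Y] [MeasurableSpace X] [BorelSpace X] [MeasurableSpace Y] [BorelSpace Y]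
    {C : ℝ≥0} {f : X → Y} {s : Set X} (h : LipschitzOnWith C f s) (d : ℕ) :
    Measure.euclideanHausdorffMeasure d (f '' s) ≤
      (C : ℝ≥0∞) ^ d * Measure.euclideanHausdorffMeasure d s := by
  rw [Measure.euclideanHausdorffMeasure_def, Measure.euclideanHausdorffMeasure_def,
    Measure.smul_apply, Measure.smul_apply, ENNReal.smul_def, ENNReal.smul_def, smul_eq_mul,
    smul_eq_mul, mul_left_comm]
  gcongr
  have := h.hausdorffMeasure_image_le (d := d) (by positivity)
  rwa [ENNReal.rpow_natCast] at this

variable {n : ℕ}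

/-- The set of all `t • b` with `0 < t < 1` and `b ∈ B`, for a subset `B` of the hyperplane
`⟪x, N⟫ = h`. -/
def hyperplaneCone (N : EuclideanSpace ℝ (Fin n)) (h : ℝ) (B : Set (EuclideanSpace ℝ (Fin n))) :
    Set (EuclideanSpace ℝ (Fin n)) :=
  {x | 0 < ⟪x, N⟫ ∧ ⟪x, N⟫ < h ∧ (h / ⟪x, N⟫) • x ∈ B}

theorem measurableSet_hyperplaneCone (N : EuclideanSpace ℝ (Fin n)) (h : ℝ)
    {B : Set (EuclideanSpace ℝ (Fin n))} (hB : MeasurableSet B) :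
    MeasurableSet (hyperplaneCone N h B) := by
  have hm : Measurable fun x : EuclideanSpace ℝ (Fin n) => ⟪x, N⟫ := by fun_prop
  exact (measurableSet_lt measurable_const hm).inter
    ((measurableSet_lt hm measurable_const).inter
      (((measurable_const.div hm).smul measurable_id) hB))

/-- In dimension `n`, the parallel sections of a cone of height `h` have areas whose integral is
`h / n` times the area of the base. -/
theorem lintegral_Ioo_div_pow (n : ℕ) (hn : 1 ≤ n) {h : ℝ} (hh : 0 < h) :
    (n : ℝ≥0∞) * ∫⁻ t in Ioo 0 h, ENNReal.ofReal (t / h) ^ (n - 1) = ENNReal.ofReal h := by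
  obtain ⟨m, rfl⟩ : ∃ m, n = m + 1 := ⟨n - 1, by omega⟩
  have e : ∫⁻ t in Ioo 0 h, ENNReal.ofReal (t / h) ^ m
      = ∫⁻ t in Ioo 0 h, ENNReal.ofReal ((t / h) ^ m) := by
    refine setLIntegral_congr_fun measurableSet_Ioo fun t ht => ?_
    rw [ENNReal.ofReal_pow (div_nonneg ht.1.le hh.le)]
  have hi : IntegrableOn (fun t : ℝ => (t / h) ^ m) (Ioo 0 h) := by
    refine Continuous.integrableOn_Icc (by fun_prop) |>.mono_set Ioo_subset_Icc_self
  rw [Nat.add_sub_cancel, e, ← ofReal_integral_eq_lintegral_ofReal hi,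
    ← integral_Ioc_eq_integral_Ioo,
    ← intervalIntegral.integral_of_le hh.le]
  · have : ∫ t in (0 : ℝ)..h, (t / h) ^ m = h / (m + 1) := by
      rw [intervalIntegral.integral_comp_div (fun t => t ^ m) hh.ne', integral_pow]
      simp [hh.ne', div_eq_mul_inv]
    rw [this, ← ENNReal.ofReal_natCast, ← ENNReal.ofReal_mul (by positivity)]
    congr 1
    push_cast
    field_simp
  · filter_upwards [ae_restrict_mem measurableSet_Ioo] with t ht
    exact pow_nonneg (div_nonneg ht.1.le hh.le) _

/-- The volume of a cone over a subset of a hyperplane at distance `h` from the origin. -/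
theorem volume_hyperplaneCone (hn : 1 ≤ n) {N : EuclideanSpace ℝ (Fin n)} (hN : ‖N‖ = 1) {h : ℝ}
    (hh : 0 < h) {B : Set (EuclideanSpace ℝ (Fin n))} (hB : MeasurableSet B)
    (hBN : ∀ b ∈ B, ⟪b, N⟫ = h) :
    (n : ℝ≥0∞) * volume (hyperplaneCone N h B) =
      ENNReal.ofReal h * Measure.euclideanHausdorffMeasure (n - 1) B := by
  have hNN : ⟪N, N⟫ = 1 := by rw [real_inner_self_eq_norm_sq, hN, one_pow]
  have h1 := EuclideanGeometry.euclideanHausdorffMeasure_eq_lintegral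
    (0 : EuclideanSpace ℝ (Fin n)) (v := N) (by rw [← norm_pos_iff, hN]; norm_num)
    (measurableSet_hyperplaneCone N h hB)
  rw [finrank_euclideanSpace_fin, EuclideanSpace.euclideanHausdorffMeasure_eq_volume] at h1
  have hNe : ‖N‖ₑ = 1 := by rw [← ofReal_norm, hN, ENNReal.ofReal_one]
  rw [h1, hNe, one_mul]
  have hslice : ∀ t : ℝ, Measure.euclideanHausdorffMeasure (n - 1) (hyperplaneCone N h B ∩
        (AffineSubspace.mk' (t • N +ᵥ (0 : EuclideanSpace ℝ (Fin n))) (Submodule.span ℝ {N})ᗮ :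
          Set (EuclideanSpace ℝ (Fin n)))) =
      (Ioo 0 h).indicator (fun t => ENNReal.ofReal (t / h) ^ (n - 1) *
        Measure.euclideanHausdorffMeasure (n - 1) B) t := by
    intro t
    have hmem : ∀ x, x ∈ (AffineSubspace.mk' (t • N +ᵥ (0 : EuclideanSpace ℝ (Fin n)))
        (Submodule.span ℝ {N})ᗮ : Set (EuclideanSpace ℝ (Fin n))) ↔ ⟪x, N⟫ = t := by
      intro x
      rw [SetLike.mem_coe, AffineSubspace.mem_mk',
        Submodule.mem_orthogonal_singleton_iff_inner_left]
      simp [inner_sub_left, inner_smul_left, hN, sub_eq_zero]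
    by_cases ht : t ∈ Ioo 0 h
    · rw [indicator_of_mem ht]
      have hr : t / h ≠ 0 := (div_pos ht.1 hh).ne'
      have hset : hyperplaneCone N h B ∩ (AffineSubspace.mk' (t • N +ᵥ (0 : EuclideanSpace ℝ (Fin n)))
          (Submodule.span ℝ {N})ᗮ : Set (EuclideanSpace ℝ (Fin n))) = (t / h) • B := by
        ext x
        rw [mem_inter_iff, hmem, mem_smul_set_iff_inv_smul_mem₀ hr]
        constructor
        · rintro ⟨⟨_, _, hx⟩, hxt⟩
          rwa [inv_div, ← hxt]
        · intro hx
          have h2 := hBN _ hx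
          rw [inner_smul_left, inv_div, conj_trivial] at h2
          have hxt : ⟪x, N⟫ = t := by
            have := ht.1.ne'
            field_simp at h2
            exact h2
          refine ⟨⟨hxt ▸ ht.1, hxt ▸ ht.2, ?_⟩, hxt⟩
          rwa [hxt, ← inv_div]
      rw [hset, Measure.euclideanHausdorffMeasure_smul₀ _ hr, ENNReal.smul_def, smul_eq_mul]
      congr 1
      rw [ENNReal.coe_pow]
      congr 1
      rw [← enorm_eq_nnnorm, Real.enorm_of_nonneg (div_pos ht.1 hh).le]
    · rw [indicator_of_notMem ht]
      have : hyperplaneCone N h B ∩ (AffineSubspace.mk' (t • N +ᵥ (0 : EuclideanSpace ℝ (Fin n)))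
          (Submodule.span ℝ {N})ᗮ : Set (EuclideanSpace ℝ (Fin n))) = ∅ := by
        ext x
        rw [mem_inter_iff, hmem]
        simp only [mem_empty_iff_false, iff_false, not_and]
        rintro ⟨hx1, hx2, _⟩ rfl
        exact ht ⟨hx1, hx2⟩
      rw [this, measure_empty]
  simp_rw [hslice]
  rw [lintegral_indicator measurableSet_Ioo, lintegral_mul_const _ (by fun_prop), ← mul_assoc,
    lintegral_Ioo_div_pow n hn hh]

end Hyperplane

/-! ### Locally comparable measures -/

section LocalComparison

open scoped Pointwise NNReal ENNReal

/-- A local comparison of two measures is global on a second countable space, since countably many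
of the neighbourhoods cover and can be made disjoint. -/
theorem MeasureTheory.Measure.le_mul_of_locally_le {X : Type*} [TopologicalSpace X]
    [SecondCountableTopology X] [MeasurableSpace X] [OpensMeasurableSpace X] {μ ν : Measure X}
    {S : Set X} {c : ℝ≥0∞}
    (H : ∀ z ∈ S, ∃ U ∈ 𝓝 z, ∀ A, MeasurableSet A → A ⊆ U ∩ S → μ A ≤ c * ν A)
    {A : Set X} (hA : MeasurableSet A) (hAS : A ⊆ S) : μ A ≤ c * ν A := by
  choose! U hU hUA using H
  obtain ⟨t, hts, htc, hcover⟩ := TopologicalSpace.countable_cover_nhdsWithin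
    (f := fun z => interior (U z)) (s := S)
    (fun z hz => mem_nhdsWithin_of_mem_nhds (interior_mem_nhds.2 (hU z hz)))
  rcases t.eq_empty_or_nonempty with rfl | hne
  · have : A = ∅ := by
      simp only [mem_empty_iff_false, iUnion_of_empty, iUnion_empty, subset_empty_iff] at hcover
      rw [hcover] at hAS
      exact subset_empty_iff.1 hAS
    simp [this]
  · obtain ⟨f, rfl⟩ := htc.exists_eq_range hne
    set W : ℕ → Set X := fun i => A ∩ disjointed (fun i => interior (U (f i))) i with hW
    have hWm : ∀ i, MeasurableSet (W i) := fun i =>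
      hA.inter (MeasurableSet.disjointed (fun i => isOpen_interior.measurableSet) i)
    have hWd : Pairwise (Function.onFun Disjoint W) := fun i j hij =>
      (disjoint_disjointed _ hij).mono inter_subset_right inter_subset_right
    have hWu : A = ⋃ i, W i := by
      rw [hW, ← inter_iUnion, iUnion_disjointed, eq_comm, inter_eq_left]
      refine hAS.trans (hcover.trans ?_)
      simp
    have hWS : ∀ i, W i ⊆ U (f i) ∩ S := fun i x hx =>
      ⟨interior_subset (disjointed_subset _ i hx.2), hAS hx.1⟩
    rw [hWu, measure_iUnion hWd hWm, measure_iUnion hWd hWm, ← ENNReal.tsum_mul_left]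
    exact ENNReal.tsum_le_tsum fun i => hUA _ (hts (mem_range_self i)) _ (hWm i) (hWS i)

theorem ENNReal.le_of_forall_one_lt_le_pow_mul {a b : ℝ≥0∞} (k : ℕ)
    (h : ∀ s : ℝ≥0, 1 < s → a ≤ (s : ℝ≥0∞) ^ k * b) : a ≤ b := by
  have h1 : Tendsto (fun s : ℝ≥0 => (s : ℝ≥0∞) ^ k * b) (𝓝[>] 1)
      (𝓝 (((1 : ℝ≥0) : ℝ≥0∞) ^ k * b)) := by
    refine ENNReal.Tendsto.mul_const ?_ (Or.inl (by simp))
    have : Continuous fun s : ℝ≥0 => (s : ℝ≥0∞) ^ k :=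
      (ENNReal.continuous_pow k).comp ENNReal.continuous_coe
    exact this.continuousAt.tendsto.mono_left nhdsWithin_le_nhds
  simp only [ENNReal.coe_one, one_pow, one_mul] at h1
  exact ge_of_tendsto h1 (by filter_upwards [self_mem_nhdsWithin] with s hs using h s hs)

/-- Two measures whose ratio is locally between `s ^ (-k)` and `s ^ k`, for every `s > 1`,
coincide. -/
theorem MeasureTheory.Measure.restrict_eq_of_locally_comparable {X : Type*} [TopologicalSpace X]
    [SecondCountableTopology X] [MeasurableSpace X] [OpensMeasurableSpace X] {μ ν : Measure X}
    {S : Set X} (hS : MeasurableSet S) (k : ℕ)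
    (H : ∀ s : ℝ≥0, 1 < s → ∀ z ∈ S, ∃ U ∈ 𝓝 z, ∀ A, MeasurableSet A → A ⊆ U ∩ S →
      μ A ≤ (s : ℝ≥0∞) ^ k * ν A ∧ ν A ≤ (s : ℝ≥0∞) ^ k * μ A) :
    μ.restrict S = ν.restrict S := by
  ext A hA
  rw [Measure.restrict_apply hA, Measure.restrict_apply hA]
  refine le_antisymm ?_ ?_
  · refine ENNReal.le_of_forall_one_lt_le_pow_mul k fun s hs => ?_
    refine Measure.le_mul_of_locally_le (S := S) (fun z hz => ?_) (hA.inter hS) inter_subset_right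
    obtain ⟨U, hU, h⟩ := H s hs z hz
    exact ⟨U, hU, fun A hA hAU => (h A hA hAU).1⟩
  · refine ENNReal.le_of_forall_one_lt_le_pow_mul k fun s hs => ?_
    refine Measure.le_mul_of_locally_le (S := S) (fun z hz => ?_) (hA.inter hS) inter_subset_right
    obtain ⟨U, hU, h⟩ := H s hs z hz
    exact ⟨U, hU, fun A hA hAU => (h A hA hAU).2⟩

end LocalComparison

/-! ### The radial projection near a boundary point -/

section RadialProjection

open scoped NNReal

variable {V : Type*} [NormedAddCommGroup V] [NormedSpace ℝ V] {K : Set V}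

theorem hasStrictFDerivAt_radialProj (hc : Convex ℝ K) (h0 : K ∈ 𝓝 0) {g' : V →L[ℝ] ℝ} {z : V}
    (h : HasFDerivAt (gauge K) g' z) (hz : gauge K z = 1) :
    HasStrictFDerivAt (radialProj K) (ContinuousLinearMap.id ℝ V - g'.smulRight z) z := by
  have h1 := (convexOn_gauge hc h0).hasStrictFDerivAt h
  have h2 : HasStrictFDerivAt (fun x => (gauge K x)⁻¹) (-g') z := by
    have := (hasStrictDerivAt_inv (x := gauge K z) (by rw [hz]; norm_num)).comp_hasStrictFDerivAt z h1
    convert! this using 1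
    ext v
    simp [hz]
  have h3 := h2.smul (hasStrictFDerivAt_id z)
  convert! h3 using 1
  ext v
  simp [hz, sub_eq_add_neg]

/-- Near a boundary point `z`, the radial projection is almost isometric on the tangent
hyperplane at `z`. -/
theorem exists_nhds_radialProj_almost_isometry (hc : Convex ℝ K) (h0 : K ∈ 𝓝 0) {g' : V →L[ℝ] ℝ}
    {z : V} (h : HasFDerivAt (gauge K) g' z) (hz : gauge K z = 1) {s : ℝ} (hs : 1 < s) :
    ∃ U ∈ 𝓝 z, ∀ x ∈ U, ∀ y ∈ U, g' x = g' y →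
      ‖radialProj K x - radialProj K y‖ ≤ s * ‖x - y‖ ∧
      ‖x - y‖ ≤ s * ‖radialProj K x - radialProj K y‖ := by
  have hs0 : 0 < s := by linarith
  have hδ : 0 < 1 - s⁻¹ := by
    have : s⁻¹ < 1 := inv_lt_one_of_one_lt₀ hs
    linarith
  obtain ⟨U, hU, hap⟩ := (hasStrictFDerivAt_radialProj hc h0 h hz).approximates_deriv_on_nhds
    (c := (1 - s⁻¹).toNNReal) (Or.inr (Real.toNNReal_pos.2 hδ))
  refine ⟨U, hU, fun x hx y hy hxy => ?_⟩
  have h1 := hap x hx y hy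
  have e : (ContinuousLinearMap.id ℝ V - g'.smulRight z) (x - y) = x - y := by
    simp [hxy]
  rw [e, Real.coe_toNNReal _ hδ.le] at h1
  have h2 := norm_sub_norm_le (radialProj K x - radialProj K y) (x - y)
  have h3 := norm_sub_norm_le (x - y) (radialProj K x - radialProj K y)
  rw [norm_sub_rev (x - y) (radialProj K x - radialProj K y)] at h3
  have hn := norm_nonneg (x - y)
  have hss : s * s⁻¹ = 1 := mul_inv_cancel₀ hs0.ne'
  have hs2 : 2 - s⁻¹ ≤ s := by
    have : 0 ≤ (s - 1) ^ 2 * s⁻¹ := by positivity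
    nlinarith
  constructor
  · calc _ ≤ (2 - s⁻¹) * ‖x - y‖ := by linarith
      _ ≤ _ := by gcongr
  · have : s⁻¹ * ‖x - y‖ ≤ ‖radialProj K x - radialProj K y‖ := by linarith
    rwa [inv_mul_le_iff₀ hs0] at this

theorem exists_nhds_lipschitzOnWith_radialProj (hc : Convex ℝ K) (h0 : K ∈ 𝓝 0)
    (hb : Bornology.IsBounded K) {z : V} (hz : z ≠ 0) :
    ∃ C : ℝ≥0, ∃ U ∈ 𝓝 z, LipschitzOnWith C (radialProj K) U := by
  obtain ⟨L, hL⟩ := hc.lipschitz_gauge h0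
  have hgz := gauge_pos_of_ne h0 hb hz
  set m := gauge K z / 2 with hm
  have hm0 : 0 < m := by positivity
  set M := ‖z‖ + 1 with hM
  refine ⟨(m⁻¹ + L * M / m ^ 2).toNNReal, {x | m < gauge K x} ∩ Metric.ball z 1, ?_, ?_⟩
  · refine inter_mem ?_ (Metric.ball_mem_nhds _ one_pos)
    exact (continuous_gauge hc h0).continuousAt.eventually_const_lt (by rw [hm]; linarith)
  · refine LipschitzOnWith.of_dist_le_mul fun x hx y hy => ?_
    have hx1 : m < gauge K x := hx.1
    have hy1 : m < gauge K y := hy.1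
    have hxp : 0 < gauge K x := hm0.trans hx1
    have hyp : 0 < gauge K y := hm0.trans hy1
    rw [Real.coe_toNNReal _ (by positivity), dist_eq_norm, dist_eq_norm]
    have e : radialProj K x - radialProj K y =
        (gauge K x)⁻¹ • (x - y) + ((gauge K x)⁻¹ - (gauge K y)⁻¹) • y := by
      simp only [radialProj]; module
    have hyM : ‖y‖ ≤ M := by
      have := mem_ball_iff_norm.1 hy.2
      linarith [norm_le_norm_add_norm_sub' y z]
    have hg : |gauge K y - gauge K x| ≤ L * ‖x - y‖ := by
      have := hL.dist_le_mul y x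
      rwa [Real.dist_eq, dist_comm, dist_eq_norm] at this
    rw [e]
    refine (norm_add_le _ _).trans ?_
    rw [norm_smul, norm_smul, add_mul]
    refine add_le_add ?_ ?_
    · rw [Real.norm_of_nonneg (inv_nonneg.2 hxp.le)]
      gcongr
    · rw [inv_sub_inv hxp.ne' hyp.ne', norm_div, Real.norm_eq_abs,
        Real.norm_of_nonneg (mul_pos hxp hyp).le]
      calc |gauge K y - gauge K x| / (gauge K x * gauge K y) * ‖y‖
          ≤ L * ‖x - y‖ / (m * m) * M := by gcongr
        _ = _ := by ring

/-- The derivative of the gauge is continuous on the set of its points of differentiability. -/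
theorem continuousWithinAt_fderiv_gauge (hc : Convex ℝ K) (h0 : K ∈ 𝓝 0) {z : V}
    (h : DifferentiableAt ℝ (gauge K) z) :
    ContinuousWithinAt (fderiv ℝ (gauge K)) {x | DifferentiableAt ℝ (gauge K) x} z := by
  rw [Metric.continuousWithinAt_iff']
  intro ε hε
  have hst := (convexOn_gauge hc h0).hasStrictFDerivAt h.hasFDerivAt
  obtain ⟨U, hU, hap⟩ := hst.approximates_deriv_on_nhds
    (c := (ε / 2).toNNReal) (Or.inr (Real.toNNReal_pos.2 (half_pos hε)))
  filter_upwards [mem_nhdsWithin_of_mem_nhds (interior_mem_nhds.2 hU), self_mem_nhdsWithin]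
    with x hx hdx
  have hlip : LipschitzOnWith (ε / 2).toNNReal (gauge K - ⇑(fderiv ℝ (gauge K) z)) U := by
    rw [lipschitzOnWith_iff_restrict]; exact hap.lipschitz_sub
  have hd : HasFDerivAt (gauge K - ⇑(fderiv ℝ (gauge K) z))
      (fderiv ℝ (gauge K) x - fderiv ℝ (gauge K) z) x :=
    HasFDerivAt.sub (DifferentiableAt.hasFDerivAt hdx) (fderiv ℝ (gauge K) z).hasFDerivAt
  have := hd.le_of_lipschitzOn (mem_interior_iff_mem_nhds.1 hx) hlip
  rw [dist_eq_norm]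
  rw [Real.coe_toNNReal _ (half_pos hε).le] at this
  linarith

end RadialProjection

/-! ### The cone measure -/

section ConeMeasure

open scoped Pointwise NNReal ENNReal

variable {n : ℕ} {K : Set (EuclideanSpace ℝ (Fin n))} {z : EuclideanSpace ℝ (Fin n)}

theorem measurable_radialProj (hc : Convex ℝ K) (h0 : K ∈ 𝓝 0) : Measurable (radialProj K) :=
  ((continuous_gauge hc h0).measurable.inv).smul measurable_id

/-- The cone measure of `K`: its value at `A` is `n` times the volume of the part of `K` that
projects radially into `A`. -/
noncomputable def coneMeasure (K : Set (EuclideanSpace ℝ (Fin n))) :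
    Measure (EuclideanSpace ℝ (Fin n)) :=
  (n : ℝ≥0∞) • (volume.restrict {x | gauge K x < 1}).map (radialProj K)

theorem coneMeasure_apply (hc : Convex ℝ K) (h0 : K ∈ 𝓝 0) {A : Set (EuclideanSpace ℝ (Fin n))}
    (hA : MeasurableSet A) :
    coneMeasure K A = n * volume (radialProj K ⁻¹' A ∩ {x | gauge K x < 1}) := by
  rw [coneMeasure, Measure.smul_apply, Measure.map_apply (measurable_radialProj hc h0) hA,
    Measure.restrict_apply (measurable_radialProj hc h0 hA), smul_eq_mul]

theorem volume_le_of_subset_smul {s : ℝ≥0} {S T : Set (EuclideanSpace ℝ (Fin n))}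
    (h : S ⊆ (s : ℝ) • T) : volume S ≤ (s : ℝ≥0∞) ^ n * volume T := by
  refine (measure_mono h).trans_eq ?_
  rw [Measure.addHaar_smul, finrank_euclideanSpace_fin, abs_of_nonneg (by positivity),
    ENNReal.ofReal_pow s.coe_nonneg, ENNReal.ofReal_coe_nnreal]

theorem norm_gradient_eq (f : EuclideanSpace ℝ (Fin n) → ℝ) (x : EuclideanSpace ℝ (Fin n)) :
    ‖gradient f x‖ = ‖fderiv ℝ f x‖ := by
  rw [gradient, LinearIsometryEquiv.norm_map]

/-- Near a boundary point `z` with a tangent hyperplane, cone measure and Hausdorff measure differ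
by a factor close to the distance of the tangent hyperplane from the origin. -/
theorem exists_nhds_coneMeasure_comparable (hn : 1 ≤ n) (hc : Convex ℝ K) (h0 : K ∈ 𝓝 0)
    (hb : Bornology.IsBounded K) (hd : DifferentiableAt ℝ (gauge K) z) (hz : gauge K z = 1)
    {s : ℝ≥0} (hs : 1 < s) :
    ∃ U ∈ 𝓝 z, ∀ A, MeasurableSet A → A ⊆ U → A ⊆ {x | gauge K x = 1} →
      coneMeasure K A ≤ (s : ℝ≥0∞) ^ n * ((s : ℝ≥0∞) ^ (n - 1) *
        (ENNReal.ofReal ‖fderiv ℝ (gauge K) z‖⁻¹ * Measure.euclideanHausdorffMeasure (n - 1) A)) ∧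
      ENNReal.ofReal ‖fderiv ℝ (gauge K) z‖⁻¹ * Measure.euclideanHausdorffMeasure (n - 1) A ≤
        (s : ℝ≥0∞) ^ (n - 1) * ((s : ℝ≥0∞) ^ n * coneMeasure K A) := by
  have hs1 : (1 : ℝ) < s := by exact_mod_cast hs
  have hs0 : (0 : ℝ) < s := by linarith
  set g' := fderiv ℝ (gauge K) z with hg'
  have hne := gradient_gauge_ne_zero hd hz
  have hpos : 0 < ‖gradient (gauge K) z‖ := norm_pos_iff.2 hne
  set N := ‖gradient (gauge K) z‖⁻¹ • gradient (gauge K) z with hN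
  set h := ‖g'‖⁻¹ with hh
  have hhe : h = ‖gradient (gauge K) z‖⁻¹ := by rw [hh, hg', ← norm_gradient_eq]
  have hh0 : 0 < h := by rw [hhe]; positivity
  have hN1 : ‖N‖ = 1 := by rw [hN, norm_smul, norm_inv, norm_norm, inv_mul_cancel₀ hpos.ne']
  have hNin : ∀ x, ⟪x, N⟫ = h * g' x := by
    intro x
    rw [hN, real_inner_smul_right, real_inner_comm, inner_gradient_eq_fderiv, hhe]
  have hg'z : g' z = 1 := by rw [hg', fderiv_gauge_self hd.hasFDerivAt, hz]
  obtain ⟨V', hV', hiso⟩ := exists_nhds_radialProj_almost_isometry hc h0 hd.hasFDerivAt hz hs1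
  set V := interior V' ∩ {x | gauge K x < s} with hV
  have hVo : IsOpen V := isOpen_interior.inter
    (isOpen_lt (continuous_gauge hc h0) continuous_const)
  have hzV : z ∈ V := ⟨mem_interior_iff_mem_nhds.2 hV', by rw [mem_ofPred_eq, hz]; exact hs1⟩
  -- the central projection onto the tangent hyperplane, locally inverse to the radial projection
  set R : EuclideanSpace ℝ (Fin n) → EuclideanSpace ℝ (Fin n) := fun a => (g' a)⁻¹ • a with hR
  have hRz : R z = z := by simp [hR, hg'z]
  have hRc : ContinuousAt R z :=
    (g'.continuous.continuousAt.inv₀ (by rw [hg'z]; norm_num)).smul continuousAt_id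
  refine ⟨R ⁻¹' V ∩ ({a | 0 < g' a} ∩ {a | g' a < s}), ?_, ?_⟩
  · refine inter_mem (hRc (by rw [hRz]; exact hVo.mem_nhds hzV)) (inter_mem ?_ ?_)
    · exact g'.continuous.continuousAt.eventually_const_lt (by rw [hg'z]; norm_num)
    · exact g'.continuous.continuousAt.eventually_lt_const (by rw [hg'z]; exact hs1)
  intro A hA hAU hA1
  set B := {x | g' x = 1} ∩ V ∩ radialProj K ⁻¹' A with hB
  have hBm : MeasurableSet B :=
    ((isClosed_eq g'.continuous continuous_const).measurableSet.inter hVo.measurableSet).inter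
      (measurable_radialProj hc h0 hA)
  have hg'R : ∀ a ∈ A, g' (R a) = 1 := fun a ha => by
    simp only [hR, map_smul, smul_eq_mul]
    exact inv_mul_cancel₀ (hAU ha).2.1.ne'
  have hπR : ∀ a ∈ A, radialProj K (R a) = a := fun a ha => by
    simp only [hR]
    rw [radialProj_smul (inv_pos.2 (hAU ha).2.1), radialProj_eq_self (hA1 ha)]
  have hRB : ∀ a ∈ A, R a ∈ B := fun a ha =>
    ⟨⟨hg'R a ha, (hAU ha).1⟩, by rw [mem_preimage, hπR a ha]; exact ha⟩
  have hRπ : ∀ b ∈ B, R (radialProj K b) = b := fun b hb' => by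
    have hb1 : g' b = 1 := hb'.1.1
    have hbne : b ≠ 0 := by rintro rfl; simp at hb1
    have hgb := gauge_pos_of_ne h0 hb hbne
    simp only [hR, radialProj, map_smul, smul_eq_mul, hb1, mul_one, inv_inv]
    rw [smul_inv_smul₀ hgb.ne']
  have hAB : A = radialProj K '' B := by
    ext a
    exact ⟨fun ha => ⟨R a, hRB a ha, hπR a ha⟩, by rintro ⟨b, hb', rfl⟩; exact hb'.2⟩
  have hBA : B = R '' A := by
    ext b
    exact ⟨fun hb' => ⟨radialProj K b, hb'.2, hRπ b hb'⟩,
      by rintro ⟨a, ha, rfl⟩; exact hRB a ha⟩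
  have hVV' : ∀ x ∈ V, x ∈ V' := fun x hx => interior_subset hx.1
  have hlip1 : LipschitzOnWith s (radialProj K) B :=
    LipschitzOnWith.of_dist_le_mul fun x hx y hy => by
      rw [dist_eq_norm, dist_eq_norm]
      exact (hiso x (hVV' x hx.1.2) y (hVV' y hy.1.2) (hx.1.1.trans hy.1.1.symm)).1
  have hlip2 : LipschitzOnWith s R A :=
    LipschitzOnWith.of_dist_le_mul fun x hx y hy => by
      rw [dist_eq_norm, dist_eq_norm]
      have := (hiso (R x) (hVV' _ (hAU hx).1) (R y) (hVV' _ (hAU hy).1)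
        ((hg'R x hx).trans (hg'R y hy).symm)).2
      rwa [hπR x hx, hπR y hy] at this
  have hHA : Measure.euclideanHausdorffMeasure (n - 1) A ≤
      (s : ℝ≥0∞) ^ (n - 1) * Measure.euclideanHausdorffMeasure (n - 1) B := by
    conv_lhs => rw [hAB]
    exact hlip1.euclideanHausdorffMeasure_image_le _
  have hHB : Measure.euclideanHausdorffMeasure (n - 1) B ≤
      (s : ℝ≥0∞) ^ (n - 1) * Measure.euclideanHausdorffMeasure (n - 1) A := by
    conv_lhs => rw [hBA]
    exact hlip2.euclideanHausdorffMeasure_image_le _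
  have hcone := volume_hyperplaneCone hn hN1 hh0 hBm (fun b hb' => by
    rw [hNin, hb'.1.1, mul_one])
  have hT : ∀ x, x ∈ hyperplaneCone N h B ↔ 0 < g' x ∧ g' x < 1 ∧ R x ∈ B := by
    intro x
    have e : h / (h * g' x) = (g' x)⁻¹ := by
      rw [div_mul_eq_div_div, div_self hh0.ne', one_div]
    simp only [hyperplaneCone, mem_ofPred_eq, hNin, mul_pos_iff_of_pos_left hh0, e,
      mul_lt_iff_lt_one_right hh0, hR]
  -- near `z` the tangent hyperplane and the boundary of `K` lie within a factor `s` of each other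
  -- along rays, so each of the cones over `A` and over `B` is contained in `s` times the other
  have hsub1 : radialProj K ⁻¹' A ∩ {x | gauge K x < 1} ⊆ (s : ℝ) • hyperplaneCone N h B := by
    intro x hx
    have hxA : radialProj K x ∈ A := hx.1
    have hxg : gauge K x < 1 := hx.2
    have hxne : x ≠ 0 := by
      rintro rfl
      have := hA1 hxA
      simp [radialProj] at this
    have hgx := gauge_pos_of_ne h0 hb hxne
    have hxe : x = gauge K x • radialProj K x := by
      rw [radialProj, smul_inv_smul₀ hgx.ne']
    have hg'x : g' x = gauge K x * g' (radialProj K x) := by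
      conv_lhs => rw [hxe, map_smul, smul_eq_mul]
    have hp1 : 0 < g' (radialProj K x) := (hAU hxA).2.1
    have hp2 : g' (radialProj K x) < s := (hAU hxA).2.2
    rw [mem_smul_set_iff_inv_smul_mem₀ hs0.ne', hT]
    simp only [map_smul, smul_eq_mul]
    refine ⟨?_, ?_, ?_⟩
    · rw [hg'x]; positivity
    · rw [inv_mul_lt_iff₀ hs0, hg'x, mul_one]
      nlinarith
    · have e : R ((s : ℝ)⁻¹ • x) = R (radialProj K x) := by
        simp only [hR, map_smul, smul_eq_mul, radialProj, mul_inv, inv_inv, smul_smul]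
        congr 1
        field_simp
      rw [e]
      exact hRB _ hxA
  have hsub2 : hyperplaneCone N h B ⊆ (s : ℝ) • (radialProj K ⁻¹' A ∩ {x | gauge K x < 1}) := by
    intro x hx
    obtain ⟨hx0, hx1, hxB⟩ := (hT x).1 hx
    have hxe : x = g' x • R x := by
      simp only [hR]; rw [smul_inv_smul₀ hx0.ne']
    rw [mem_smul_set_iff_inv_smul_mem₀ hs0.ne']
    refine ⟨?_, ?_⟩
    · rw [mem_preimage, radialProj_smul (inv_pos.2 hs0), hxe, radialProj_smul hx0]
      exact hxB.2
    · have hgb : gauge K (R x) < s := hxB.1.2.2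
      rw [mem_ofPred_eq, gauge_smul_nonneg (inv_nonneg.2 hs0.le), inv_mul_lt_iff₀ hs0, mul_one]
      conv_lhs => rw [hxe]
      rw [gauge_smul_nonneg hx0.le]
      nlinarith [gauge_nonneg (s := K) (R x)]
  have hv1 := volume_le_of_subset_smul hsub1
  have hv2 := volume_le_of_subset_smul hsub2
  rw [coneMeasure_apply hc h0 hA]
  constructor
  · calc (n : ℝ≥0∞) * volume (radialProj K ⁻¹' A ∩ {x | gauge K x < 1})
        ≤ n * ((s : ℝ≥0∞) ^ n * volume (hyperplaneCone N h B)) := by gcongr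
      _ = (s : ℝ≥0∞) ^ n * (ENNReal.ofReal h * Measure.euclideanHausdorffMeasure (n - 1) B) := by
          rw [← hcone]; ring
      _ ≤ (s : ℝ≥0∞) ^ n * (ENNReal.ofReal h *
          ((s : ℝ≥0∞) ^ (n - 1) * Measure.euclideanHausdorffMeasure (n - 1) A)) := by gcongr
      _ = _ := by ring
  · calc ENNReal.ofReal h * Measure.euclideanHausdorffMeasure (n - 1) A
        ≤ ENNReal.ofReal h * ((s : ℝ≥0∞) ^ (n - 1) *
          Measure.euclideanHausdorffMeasure (n - 1) B) := by gcongr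
      _ = (s : ℝ≥0∞) ^ (n - 1) * (n * volume (hyperplaneCone N h B)) := by
          rw [hcone]; ring
      _ ≤ (s : ℝ≥0∞) ^ (n - 1) * (n * ((s : ℝ≥0∞) ^ n *
          volume (radialProj K ⁻¹' A ∩ {x | gauge K x < 1}))) := by gcongr
      _ = _ := by ring

theorem measurableSet_gauge_eq_one (hc : Convex ℝ K) (h0 : K ∈ 𝓝 0) :
    MeasurableSet {x | gauge K x = 1} :=
  (isClosed_eq (continuous_gauge hc h0) continuous_const).measurableSet

theorem frontier_eq_gauge_eq_one (hc : Convex ℝ K) (h0 : K ∈ 𝓝 0) :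
    frontier K = {x | gauge K x = 1} :=
  Set.ext fun _ => (gauge_eq_one_iff_mem_frontier hc h0).symm

theorem measurableSet_differentiableAt_gauge (K : Set (EuclideanSpace ℝ (Fin n))) :
    MeasurableSet {x | DifferentiableAt ℝ (gauge K) x} :=
  measurableSet_of_differentiableAt ℝ (gauge K)

theorem measurable_norm_fderiv_gauge_inv (K : Set (EuclideanSpace ℝ (Fin n))) :
    Measurable fun x => ‖fderiv ℝ (gauge K) x‖⁻¹ :=
  (measurable_fderiv ℝ (gauge K)).norm.inv

/-- On the boundary points with a tangent hyperplane, cone measure is Hausdorff measure weighted by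
the distance of the tangent hyperplane from the origin. The weight is continuous on this set, so it
may be replaced by its value at a point in the local comparison. -/
theorem coneMeasure_restrict_eq (hn : 1 ≤ n) (hc : Convex ℝ K) (h0 : K ∈ 𝓝 0)
    (hb : Bornology.IsBounded K) :
    (coneMeasure K).restrict ({x | gauge K x = 1} ∩ {x | DifferentiableAt ℝ (gauge K) x}) =
      ((Measure.euclideanHausdorffMeasure (n - 1)).withDensity
        (fun x => ENNReal.ofReal ‖fderiv ℝ (gauge K) x‖⁻¹)).restrict
          ({x | gauge K x = 1} ∩ {x | DifferentiableAt ℝ (gauge K) x}) := by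
  refine Measure.restrict_eq_of_locally_comparable
    ((measurableSet_gauge_eq_one hc h0).inter (measurableSet_differentiableAt_gauge K))
    (n + (n - 1) + 1) fun s hs z hz => ?_
  obtain ⟨hz1, hzd⟩ := hz
  obtain ⟨U, hU, hUA⟩ := exists_nhds_coneMeasure_comparable hn hc h0 hb hzd hz1 hs
  have hs1 : (1 : ℝ) < s := by exact_mod_cast hs
  set ρ : EuclideanSpace ℝ (Fin n) → ℝ := fun x => ‖fderiv ℝ (gauge K) x‖⁻¹ with hρ
  have hne : ‖fderiv ℝ (gauge K) z‖ ≠ 0 := by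
    rw [← norm_gradient_eq]; exact norm_ne_zero_iff.2 (gradient_gauge_ne_zero hzd hz1)
  have hρz : 0 < ρ z := inv_pos.2 (lt_of_le_of_ne (norm_nonneg _) hne.symm)
  have hρc : ContinuousWithinAt ρ {x | DifferentiableAt ℝ (gauge K) x} z :=
    (continuousWithinAt_fderiv_gauge hc h0 hzd).norm.inv₀ hne
  have hev : ∀ᶠ x in 𝓝[{x | DifferentiableAt ℝ (gauge K) x}] z, ρ x ≤ s * ρ z ∧ ρ z ≤ s * ρ x := by
    have h1 : ∀ᶠ x in 𝓝[{x | DifferentiableAt ℝ (gauge K) x}] z, ρ x < s * ρ z :=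
      hρc.eventually_lt_const (by nlinarith)
    have h2 : ∀ᶠ x in 𝓝[{x | DifferentiableAt ℝ (gauge K) x}] z, ρ z < s * ρ x :=
      (continuousWithinAt_const.mul hρc).eventually_const_lt (by
        rw [Pi.mul_apply]; nlinarith)
    filter_upwards [h1, h2] with x hx hx' using ⟨hx.le, hx'.le⟩
  rw [eventually_nhdsWithin_iff] at hev
  refine ⟨_, inter_mem hU hev, fun A hA hAU => ?_⟩
  obtain ⟨hA1, hA2⟩ := hUA A hA (fun x hx => (hAU hx).1.1) (fun x hx => (hAU hx).2.1)
  have hof : ∀ {a b : ℝ}, a ≤ s * b → ENNReal.ofReal a ≤ s * ENNReal.ofReal b := by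
    intro a b hab
    rw [← ENNReal.ofReal_coe_nnreal, ← ENNReal.ofReal_mul s.coe_nonneg]
    exact ENNReal.ofReal_le_ofReal hab
  rw [withDensity_apply _ hA]
  have hM1 : ENNReal.ofReal (ρ z) * Measure.euclideanHausdorffMeasure (n - 1) A ≤
      s * ∫⁻ x in A, ENNReal.ofReal (ρ x) ∂Measure.euclideanHausdorffMeasure (n - 1) := by
    rw [← setLIntegral_const, ← lintegral_const_mul _ (by
      exact (measurable_norm_fderiv_gauge_inv K).ennreal_ofReal)]
    refine setLIntegral_mono' hA fun x hx => hof ?_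
    exact ((hAU hx).1.2 (hAU hx).2.2).2
  have hM2 : ∫⁻ x in A, ENNReal.ofReal (ρ x) ∂Measure.euclideanHausdorffMeasure (n - 1) ≤
      s * (ENNReal.ofReal (ρ z) * Measure.euclideanHausdorffMeasure (n - 1) A) := by
    rw [← mul_assoc, ← setLIntegral_const]
    refine setLIntegral_mono' hA fun x hx => hof ?_
    exact ((hAU hx).1.2 (hAU hx).2.2).1
  constructor
  · calc coneMeasure K A ≤ _ := hA1
      _ ≤ (s : ℝ≥0∞) ^ n * ((s : ℝ≥0∞) ^ (n - 1) * (s * ∫⁻ x in A, ENNReal.ofReal (ρ x)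
          ∂Measure.euclideanHausdorffMeasure (n - 1))) := by gcongr
      _ = _ := by ring
  · calc _ ≤ _ := hM2
      _ ≤ (s : ℝ≥0∞) * ((s : ℝ≥0∞) ^ (n - 1) * ((s : ℝ≥0∞) ^ n * coneMeasure K A)) := by gcongr
      _ = _ := by ring

theorem volume_not_differentiableAt_gauge (hc : Convex ℝ K) (h0 : K ∈ 𝓝 0) :
    volume {x | ¬ DifferentiableAt ℝ (gauge K) x} = 0 := by
  obtain ⟨L, hL⟩ := hc.lipschitz_gauge h0
  exact hL.ae_differentiableAt

/-- The boundary points without tangent hyperplane form a null set for the Hausdorff measure,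
because the radial projection is locally Lipschitz and the cone over them is Lebesgue null. -/
theorem hausdorffMeasure_not_differentiableAt_gauge (hn : 1 ≤ n) (hc : Convex ℝ K) (h0 : K ∈ 𝓝 0)
    (hb : Bornology.IsBounded K) :
    Measure.euclideanHausdorffMeasure (n - 1)
      ({x | gauge K x = 1} ∩ {x | ¬ DifferentiableAt ℝ (gauge K) x}) = 0 := by
  refine measure_null_of_locally_null _ fun z hz => ?_
  have hzne : z ≠ 0 := ne_zero_of_gauge_eq_one hz.1
  have hzn : 0 < ‖z‖ := norm_pos_iff.2 hzne
  -- without a tangent hyperplane at `z`, the hyperplane through `z` orthogonal to `z` serves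
  set N := ‖z‖⁻¹ • z with hN
  have hN1 : ‖N‖ = 1 := by rw [hN, norm_smul, norm_inv, norm_norm, inv_mul_cancel₀ hzn.ne']
  have hzN : ⟪z, N⟫ = ‖z‖ := by
    rw [hN, real_inner_smul_right, real_inner_self_eq_norm_sq]
    field_simp
  obtain ⟨C, V', hV', hlip⟩ := exists_nhds_lipschitzOnWith_radialProj hc h0 hb hzne
  set R : EuclideanSpace ℝ (Fin n) → EuclideanSpace ℝ (Fin n) := fun a => (‖z‖ / ⟪a, N⟫) • a with hR
  have hinc : Continuous fun a : EuclideanSpace ℝ (Fin n) => ⟪a, N⟫ := by fun_prop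
  have hRz : R z = z := by simp [hR, hzN, hzn.ne']
  have hRc : ContinuousAt R z :=
    (continuousAt_const.div hinc.continuousAt (by rw [hzN]; exact hzn.ne')).smul continuousAt_id
  set B := {x | ⟪x, N⟫ = ‖z‖} ∩ interior V' ∩ {x | ¬ DifferentiableAt ℝ (gauge K) x} with hB
  have hBm : MeasurableSet B :=
    ((isClosed_eq hinc continuous_const).measurableSet.inter isOpen_interior.measurableSet).inter
      (measurableSet_differentiableAt_gauge K).compl
  have hB0 : Measure.euclideanHausdorffMeasure (n - 1) B = 0 := by
    have h1 := volume_hyperplaneCone hn hN1 hzn hBm (fun b hb' => hb'.1.1)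
    have h2 : volume (hyperplaneCone N ‖z‖ B) = 0 := by
      refine measure_mono_null (fun x hx => ?_) (volume_not_differentiableAt_gauge hc h0)
      obtain ⟨hx1, _, hx2⟩ := hx
      have := hx2.2
      rwa [mem_ofPred_eq, differentiableAt_gauge_smul_iff (div_pos hzn hx1)] at this
    rw [h2, mul_zero, eq_comm, mul_eq_zero, ENNReal.ofReal_eq_zero] at h1
    exact h1.resolve_left (not_le.2 hzn)
  have hRV : R ⁻¹' interior V' ∈ 𝓝 z := hRc (by rw [hRz]; exact interior_mem_nhds.2 hV')
  have hpos : {a | 0 < ⟪a, N⟫} ∈ 𝓝 z :=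
    (isOpen_lt continuous_const hinc).mem_nhds (by rw [mem_ofPred_eq, hzN]; exact hzn)
  refine ⟨_, inter_mem self_mem_nhdsWithin (mem_nhdsWithin_of_mem_nhds
    (inter_mem hRV hpos)), ?_⟩
  refine measure_mono_null (t := radialProj K '' B) ?_ ?_
  · rintro a ⟨⟨ha1, had⟩, haV, ha0⟩
    have ha0' : 0 < ⟪a, N⟫ := ha0
    have hq := div_pos hzn ha0'
    refine ⟨R a, ⟨⟨?_, haV⟩, ?_⟩, ?_⟩
    · simp only [hR, mem_ofPred_eq, real_inner_smul_left]
      field_simp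
    · simp only [hR, mem_ofPred_eq]
      rwa [differentiableAt_gauge_smul_iff hq]
    · simp only [hR]
      rw [radialProj_smul hq, radialProj_eq_self ha1]
  · have hBV : B ⊆ V' := fun x hx => interior_subset hx.1.2
    have := (hlip.mono hBV).euclideanHausdorffMeasure_image_le (n - 1)
    rw [hB0, mul_zero] at this
    exact le_antisymm this zero_le

theorem coneMeasure_compl_eq_zero (hn : 1 ≤ n) (hc : Convex ℝ K) (h0 : K ∈ 𝓝 0)
    (hb : Bornology.IsBounded K) :
    coneMeasure K ({x | gauge K x = 1} ∩ {x | DifferentiableAt ℝ (gauge K) x})ᶜ = 0 := by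
  have : Nonempty (Fin n) := ⟨⟨0, by omega⟩⟩
  rw [coneMeasure_apply hc h0 ((measurableSet_gauge_eq_one hc h0).inter
    (measurableSet_differentiableAt_gauge K)).compl]
  have : volume (radialProj K ⁻¹' ({x | gauge K x = 1} ∩ {x | DifferentiableAt ℝ (gauge K) x})ᶜ ∩
      {x | gauge K x < 1}) = 0 := by
    refine measure_mono_null (t := {0} ∪ {x | ¬ DifferentiableAt ℝ (gauge K) x}) ?_
      (measure_union_null (measure_singleton 0) (volume_not_differentiableAt_gauge hc h0))
    rintro x ⟨hx, _⟩
    by_cases hx0 : x = 0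
    · exact Or.inl hx0
    · right
      intro hd
      refine hx ⟨gauge_radialProj h0 hb hx0, ?_⟩
      rw [mem_ofPred_eq, radialProj,
        differentiableAt_gauge_smul_iff (inv_pos.2 (gauge_pos_of_ne h0 hb hx0))]
      exact hd
  rw [this, mul_zero]

/-- The cone measure of `K` has density `⟪z, N_K(z)⟫ = ‖∇ gauge K z‖⁻¹` with respect to the surface
area measure. -/
theorem coneMeasure_eq_withDensity (hn : 1 ≤ n) (hc : Convex ℝ K) (h0 : K ∈ 𝓝 0)
    (hb : Bornology.IsBounded K) :
    coneMeasure K = (surfaceAreaMeasure K).withDensity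
      (fun x => ENNReal.ofReal ‖fderiv ℝ (gauge K) x‖⁻¹) := by
  have hm : MeasurableSet ({x | gauge K x = 1} ∩ {x | DifferentiableAt ℝ (gauge K) x}) :=
    (measurableSet_gauge_eq_one hc h0).inter (measurableSet_differentiableAt_gauge K)
  rw [← Measure.restrict_eq_self_of_ae_mem (μ := coneMeasure K)
    (s := {x | gauge K x = 1} ∩ {x | DifferentiableAt ℝ (gauge K) x})
    (coneMeasure_compl_eq_zero hn hc h0 hb), coneMeasure_restrict_eq hn hc h0 hb,
    restrict_withDensity hm, surfaceAreaMeasure, frontier_eq_gauge_eq_one hc h0]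
  congr 1
  refine Measure.restrict_congr_set ?_
  rw [ae_eq_set]
  refine ⟨by rw [sdiff_eq_empty.2 inter_subset_left, measure_empty], ?_⟩
  rw [sdiff_self_inter]
  exact hausdorffMeasure_not_differentiableAt_gauge hn hc h0 hb

end ConeMeasure

/-! ### Polar coordinates adapted to the body -/

section Polar

open scoped Pointwise NNReal ENNReal

variable {n : ℕ} {K : Set (EuclideanSpace ℝ (Fin n))}

/-- The integral of a function homogeneous of degree `0` over `s • K` scales like the volume. -/
theorem setLIntegral_gauge_lt (hc : Convex ℝ K) (h0 : K ∈ 𝓝 0)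
    {G : EuclideanSpace ℝ (Fin n) → ℝ≥0∞} (hG : Measurable G)
    (hGr : ∀ r : ℝ, 0 < r → ∀ x, G (r • x) = G x) {s : ℝ} (hs : 0 < s) :
    ∫⁻ x in {x | gauge K x < s}, G x =
      ENNReal.ofReal s ^ n * ∫⁻ x in {x | gauge K x < 1}, G x := by
  have hm : ∀ t, MeasurableSet {x | gauge K x < t} := fun t =>
    (isOpen_lt (continuous_gauge hc h0) continuous_const).measurableSet
  have h1 := Measure.map_addHaar_smul (volume : Measure (EuclideanSpace ℝ (Fin n))) hs.ne'
  have h2 : ∫⁻ x, {x | gauge K x < s}.indicator G x ∂(Measure.map (fun x => s • x) volume) =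
      ∫⁻ x, {x | gauge K x < 1}.indicator G x := by
    rw [lintegral_map (hG.indicator (hm s)) (by fun_prop)]
    refine lintegral_congr fun x => ?_
    by_cases hx : gauge K x < 1
    · rw [indicator_of_mem (a := x) hx, indicator_of_mem, hGr s hs]
      rw [mem_ofPred_eq, gauge_smul_nonneg hs.le]; nlinarith
    · rw [indicator_of_notMem (a := x) hx, indicator_of_notMem]
      rw [mem_ofPred_eq, gauge_smul_nonneg hs.le]; nlinarith
  rw [h1, lintegral_smul_measure, lintegral_indicator (hm s), lintegral_indicator (hm 1),
    finrank_euclideanSpace_fin, smul_eq_mul, abs_of_nonneg (by positivity)] at h2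
  rw [← h2, ← mul_assoc, ← ENNReal.ofReal_pow hs.le, ← ENNReal.ofReal_mul (by positivity),
    mul_inv_cancel₀ (by positivity), ENNReal.ofReal_one, one_mul]

/-- The Gaussian weight as an integral over its superlevel sets. -/
theorem lintegral_Ioi_mul_exp_neg_sq {t : ℝ} (ht : 0 ≤ t) :
    ∫⁻ s in Ioi t, ENNReal.ofReal (s * Real.exp (-(s ^ 2 / 2))) =
      ENNReal.ofReal (Real.exp (-(t ^ 2 / 2))) := by
  have hd : ∀ x : ℝ, HasDerivAt (fun s => -Real.exp (-(s ^ 2 / 2)))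
      (x * Real.exp (-(x ^ 2 / 2))) x := by
    intro x
    have h1 : HasDerivAt (fun s : ℝ => -(s ^ 2 / 2)) (-x) x := by
      have := ((hasDerivAt_pow 2 x).div_const 2).neg
      convert! this using 1
      simp
    convert! h1.exp.neg using 1
    ring
  have hpos : ∀ x ∈ Ioi t, 0 ≤ x * Real.exp (-(x ^ 2 / 2)) := fun x hx =>
    mul_nonneg (ht.trans (le_of_lt hx)) (Real.exp_pos _).le
  have hlim : Tendsto (fun s : ℝ => -Real.exp (-(s ^ 2 / 2))) atTop (𝓝 0) := by
    rw [← neg_zero]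
    refine (Real.tendsto_exp_neg_atTop_nhds_zero.comp ?_).neg
    exact (tendsto_pow_atTop two_ne_zero).atTop_div_const two_pos
  have hi := integrableOn_Ioi_deriv_of_nonneg' (a := t) (fun x _ => hd x) hpos hlim
  have := integral_Ioi_of_hasDerivAt_of_nonneg' (a := t) (fun x _ => hd x) hpos hlim
  rw [← ofReal_integral_eq_lintegral_ofReal hi, this]
  · simp
  · filter_upwards [ae_restrict_mem measurableSet_Ioi] with x hx using hpos x hx

/-- Layer cake formula for the weight `exp (-(gauge K) ^ 2 / 2)` and a function homogeneous of
degree `0`; the first factor on the right depends on the dimension only. -/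
theorem lintegral_mul_exp_neg_gauge_sq (hc : Convex ℝ K) (h0 : K ∈ 𝓝 0)
    {G : EuclideanSpace ℝ (Fin n) → ℝ≥0∞} (hG : Measurable G)
    (hGr : ∀ r : ℝ, 0 < r → ∀ x, G (r • x) = G x) :
    ∫⁻ x, G x * ENNReal.ofReal (Real.exp (-(gauge K x ^ 2 / 2))) =
      (∫⁻ s in Ioi (0 : ℝ), ENNReal.ofReal (s * Real.exp (-(s ^ 2 / 2))) * ENNReal.ofReal s ^ n) *
        ∫⁻ x in {x | gauge K x < 1}, G x := by
  have hgm : Measurable (gauge K) := (continuous_gauge hc h0).measurable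
  have hk : Measurable fun s : ℝ => ENNReal.ofReal (s * Real.exp (-(s ^ 2 / 2))) := by fun_prop
  have hm : ∀ t, MeasurableSet {x | gauge K x < t} := fun t =>
    (isOpen_lt (continuous_gauge hc h0) continuous_const).measurableSet
  have h1 : ∀ x, G x * ENNReal.ofReal (Real.exp (-(gauge K x ^ 2 / 2))) =
      ∫⁻ s in Ioi (0 : ℝ), {p : EuclideanSpace ℝ (Fin n) × ℝ | gauge K p.1 < p.2}.indicator
        (fun p => G p.1 * ENNReal.ofReal (p.2 * Real.exp (-(p.2 ^ 2 / 2)))) (x, s) := by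
    intro x
    rw [← lintegral_Ioi_mul_exp_neg_sq (gauge_nonneg x), ← lintegral_const_mul _ hk,
      ← lintegral_indicator measurableSet_Ioi, ← lintegral_indicator measurableSet_Ioi]
    refine lintegral_congr fun s => ?_
    by_cases hs : gauge K x < s
    · rw [indicator_of_mem (by exact hs), indicator_of_mem (by exact (gauge_nonneg x).trans_lt hs),
        indicator_of_mem (by exact hs)]
    · rw [indicator_of_notMem (by exact hs)]
      by_cases hs0 : s ∈ Ioi (0 : ℝ)
      · rw [indicator_of_mem hs0, indicator_of_notMem (by exact hs)]
      · rw [indicator_of_notMem hs0]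
  simp_rw [h1]
  have hset : MeasurableSet {p : EuclideanSpace ℝ (Fin n) × ℝ | gauge K p.1 < p.2} :=
    measurableSet_lt (hgm.comp measurable_fst) measurable_snd
  rw [lintegral_lintegral_swap]
  · rw [← lintegral_mul_const _ (by fun_prop)]
    refine setLIntegral_congr_fun measurableSet_Ioi fun s hs => ?_
    have hs' : (0 : ℝ) < s := hs
    rw [mul_assoc, ← setLIntegral_gauge_lt hc h0 hG hGr hs', mul_comm (ENNReal.ofReal _),
      ← lintegral_mul_const _ hG, ← lintegral_indicator (hm s)]
    rfl
  · refine Measurable.aemeasurable ?_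
    exact ((hG.comp measurable_fst).mul (hk.comp measurable_snd)).indicator hset

/-- The constant in the layer cake formula for a Gaussian weight. It does not depend on the body, so
it is computed for the Euclidean ball, where the Gaussian integral is known. -/
theorem lintegral_gaussian_const (n : ℕ) :
    (∫⁻ s in Ioi (0 : ℝ), ENNReal.ofReal (s * Real.exp (-(s ^ 2 / 2))) * ENNReal.ofReal s ^ n) *
        volume (Metric.closedBall (0 : EuclideanSpace ℝ (Fin n)) 1) =
      ENNReal.ofReal ((2 * Real.pi) ^ ((n : ℝ) / 2)) := by
  have hball : Metric.ball (0 : EuclideanSpace ℝ (Fin n)) 1 ∈ 𝓝 0 := Metric.ball_mem_nhds _ one_pos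
  have h1 := lintegral_mul_exp_neg_gauge_sq (convex_ball (0 : EuclideanSpace ℝ (Fin n)) 1)
    hball (G := fun _ => 1) measurable_const (fun _ _ _ => rfl)
  simp only [gauge_unit_ball, one_mul, lintegral_const, Measure.restrict_apply, MeasurableSet.univ,
    univ_inter] at h1
  have e : {x : EuclideanSpace ℝ (Fin n) | ‖x‖ < 1} = Metric.ball 0 1 := by
    ext x; simp
  rw [e] at h1
  rw [Measure.addHaar_closedBall _ _ zero_le_one, one_pow, ENNReal.ofReal_one, one_mul, ← h1]
  have h2 := GaussianFourier.integral_rexp_neg_mul_sq_norm (V := EuclideanSpace ℝ (Fin n))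
    (b := 1 / 2) (by norm_num)
  rw [finrank_euclideanSpace_fin] at h2
  have h3 : Real.pi / (1 / 2) = 2 * Real.pi := by ring
  rw [h3] at h2
  rw [← h2, ofReal_integral_eq_lintegral_ofReal]
  · refine lintegral_congr fun x => ?_
    congr 2
    ring
  · refine Integrable.of_integral_ne_zero ?_
    rw [h2]
    positivity
  · exact Eventually.of_forall fun x => (Real.exp_pos _).le

theorem lintegral_coneMeasure (hc : Convex ℝ K) (h0 : K ∈ 𝓝 0) (hb : Bornology.IsBounded K)
    {G : EuclideanSpace ℝ (Fin n) → ℝ≥0∞} (hG : Measurable G)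
    (hGr : ∀ r : ℝ, 0 < r → ∀ x, G (r • x) = G x) :
    ∫⁻ x, G x ∂(coneMeasure K) = n * ∫⁻ x in {x | gauge K x < 1}, G x := by
  rw [coneMeasure, lintegral_smul_measure, lintegral_map hG (measurable_radialProj hc h0),
    smul_eq_mul]
  congr 1
  refine lintegral_congr fun x => ?_
  by_cases hx : x = 0
  · simp [hx, radialProj]
  · rw [radialProj, hGr _ (inv_pos.2 (gauge_pos_of_ne h0 hb hx))]

/-- Integration in polar coordinates with respect to `K`, for a Gaussian weight. -/
theorem lintegral_mul_exp_eq_lintegral_surfaceAreaMeasure (hn : 1 ≤ n) (hc : Convex ℝ K)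
    (h0 : K ∈ 𝓝 0) (hb : Bornology.IsBounded K)
    {G : EuclideanSpace ℝ (Fin n) → ℝ≥0∞} (hG : Measurable G)
    (hGr : ∀ r : ℝ, 0 < r → ∀ x, G (r • x) = G x) :
    (n * volume (Metric.closedBall (0 : EuclideanSpace ℝ (Fin n)) 1)) *
        ∫⁻ x, G x * ENNReal.ofReal (Real.exp (-(gauge K x ^ 2 / 2))) =
      ENNReal.ofReal ((2 * Real.pi) ^ ((n : ℝ) / 2)) *
        ∫⁻ z, ENNReal.ofReal ‖fderiv ℝ (gauge K) z‖⁻¹ * G z ∂(surfaceAreaMeasure K) := by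
  have h1 := lintegral_coneMeasure hc h0 hb hG hGr
  rw [coneMeasure_eq_withDensity hn hc h0 hb, lintegral_withDensity_eq_lintegral_mul _
    (measurable_norm_fderiv_gauge_inv K).ennreal_ofReal hG] at h1
  simp only [Pi.mul_apply] at h1
  rw [lintegral_mul_exp_neg_gauge_sq hc h0 hG hGr, h1, ← lintegral_gaussian_const n]
  ring

end Polar

/-! ### Generalized Hessians -/

section GeneralizedHessian

variable {V : Type*} [NormedAddCommGroup V] [InnerProductSpace ℝ V] [CompleteSpace V]
  {f : V → ℝ} {A B : V →ₗ[ℝ] V} {x : V}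

/-- The quadratic form of a generalized Hessian is the limit of symmetric second differences. -/
theorem HasGeneralizedHessianAt.tendsto_secondDifference (h : HasGeneralizedHessianAt f A x)
    (v : V) :
    Tendsto (fun t : ℝ => (f (x + t • v) + f (x - t • v) - 2 * f x) / t ^ 2) (𝓝[≠] 0)
      (𝓝 ⟪A v, v⟫) := by
  have hlin : ∀ w : V, (fun t : ℝ => f (x + t • w) - f x - ⟪gradient f x, t • w⟫ -
      (1 / 2) * ⟪A (t • w), t • w⟫) =o[𝓝[≠] 0] fun t : ℝ => t ^ 2 := by
    intro w
    have ht : Tendsto (fun t : ℝ => t • w) (𝓝[≠] 0) (𝓝 0) := by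
      have : Tendsto (fun t : ℝ => t • w) (𝓝 0) (𝓝 ((0 : ℝ) • w)) :=
        (continuous_id.smul continuous_const).tendsto 0
      rw [zero_smul] at this
      exact this.mono_left nhdsWithin_le_nhds
    refine (h.2.comp_tendsto ht).trans_isBigO ?_
    refine IsBigO.of_bound (‖w‖ ^ 2) (Eventually.of_forall fun t => ?_)
    simp only [Function.comp, norm_smul, mul_pow, norm_mul, norm_pow, norm_norm]
    rw [mul_comm]
  have h2 := (hlin v).add (hlin (-v))
  have h3 := h2.tendsto_div_nhds_zero
  have h4 := h3.add_const ⟪A v, v⟫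
  rw [zero_add] at h4
  refine h4.congr' ?_
  filter_upwards [self_mem_nhdsWithin] with t ht
  have ht0 : t ≠ 0 := ht
  simp only [smul_neg, ← sub_eq_add_neg, map_neg, map_smul, inner_neg_left, inner_neg_right,
    real_inner_smul_left, real_inner_smul_right, neg_neg]
  field_simp
  ring

theorem HasGeneralizedHessianAt.unique (hA : HasGeneralizedHessianAt f A x)
    (hB : HasGeneralizedHessianAt f B x) : A = B := by
  have h : ∀ v, ⟪(A - B) v, v⟫ = 0 := fun v => by
    rw [LinearMap.sub_apply, inner_sub_left, sub_eq_zero]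
    exact tendsto_nhds_unique (hA.tendsto_secondDifference v) (hB.tendsto_secondDifference v)
  exact sub_eq_zero.1 ((hA.1.sub hB.1).inner_map_self_eq_zero.1 h)

theorem HasGeneralizedHessianAt.generalizedHessian_eq (h : HasGeneralizedHessianAt f A x) :
    generalizedHessian f x = A := by
  have hex : ∃ A, HasGeneralizedHessianAt f A x := ⟨A, h⟩
  rw [generalizedHessian, dif_pos hex]
  exact hex.choose_spec.unique h

theorem generalizedHessian_eq_zero (h : ¬ ∃ A, HasGeneralizedHessianAt f A x) :
    generalizedHessian f x = 0 := by rw [generalizedHessian, dif_neg h]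

theorem hasGeneralizedHessianAt_generalizedHessian (h : ∃ A, HasGeneralizedHessianAt f A x) :
    HasGeneralizedHessianAt f (generalizedHessian f x) x := by
  obtain ⟨A, hA⟩ := h
  rwa [hA.generalizedHessian_eq]

/-- A generalized Hessian of a convex function is positive semidefinite. -/
theorem ConvexOn.isPositive_of_hasGeneralizedHessianAt (hf : ConvexOn ℝ univ f)
    (h : HasGeneralizedHessianAt f A x) : A.IsPositive := by
  rw [LinearMap.isPositive_iff]
  refine ⟨h.1, fun v => ?_⟩
  refine ge_of_tendsto (h.tendsto_secondDifference v) (Eventually.of_forall fun t => ?_)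
  have := hf.2 (mem_univ (x + t • v)) (mem_univ (x - t • v)) (by norm_num : (0 : ℝ) ≤ 1 / 2)
    (by norm_num : (0 : ℝ) ≤ 1 / 2) (by norm_num)
  have e : (1 / 2 : ℝ) • (x + t • v) + (1 / 2 : ℝ) • (x - t • v) = x := by module
  rw [e, smul_eq_mul, smul_eq_mul] at this
  exact div_nonneg (by linarith) (sq_nonneg t)

theorem gradient_smul_of_homogeneous (hf : ∀ r : ℝ, 0 < r → ∀ x, f (r • x) = r ^ 2 * f x)
    {r : ℝ} (hr : 0 < r) (x : V) : gradient f (r • x) = r • gradient f x := by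
  have h1 := fderiv_comp_smul (𝕜 := ℝ) (f := f) (x := x) r
  have e : (fun y => f (r • y)) = (r ^ 2) • f := by
    ext y; simp [hf r hr]
  rw [e, fderiv_const_smul_field, Pi.smul_apply, sq, mul_smul] at h1
  have h2 := smul_right_injective _ hr.ne' h1
  refine ext_inner_right ℝ fun v => ?_
  rw [real_inner_smul_left, inner_gradient_eq_fderiv, inner_gradient_eq_fderiv, ← h2]
  rfl

/-- The generalized Hessian of a function homogeneous of degree `2` is homogeneous of
degree `0`. -/
theorem HasGeneralizedHessianAt.smul (hf : ∀ r : ℝ, 0 < r → ∀ x, f (r • x) = r ^ 2 * f x)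
    (h : HasGeneralizedHessianAt f A x) {r : ℝ} (hr : 0 < r) :
    HasGeneralizedHessianAt f A (r • x) := by
  refine ⟨h.1, ?_⟩
  have ht : Tendsto (fun y : V => r⁻¹ • y) (𝓝 0) (𝓝 0) := by
    have : Tendsto (fun y : V => r⁻¹ • y) (𝓝 0) (𝓝 (r⁻¹ • (0 : V))) :=
      (continuous_const_smul r⁻¹).tendsto 0
    rwa [smul_zero] at this
  have h1 := ((h.2.comp_tendsto ht).const_mul_left (r ^ 2))
  have h2 : ((fun y : V => ‖y‖ ^ 2) ∘ fun y => r⁻¹ • y) =O[𝓝 0] fun y => ‖y‖ ^ 2 := by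
    refine IsBigO.of_bound (‖r⁻¹‖ ^ 2) (Eventually.of_forall fun t => ?_)
    simp only [Function.comp, norm_smul, mul_pow, norm_mul, norm_pow, norm_norm]
    exact le_rfl
  refine (h1.trans_isBigO h2).congr_left fun y => ?_
  have e : r • x + y = r • (x + r⁻¹ • y) := by
    rw [smul_add, smul_inv_smul₀ hr.ne']
  rw [gradient_smul_of_homogeneous hf hr, e, hf r hr, hf r hr]
  simp only [Function.comp, map_smul, real_inner_smul_left, real_inner_smul_right]
  field_simp

theorem generalizedHessian_smul (hf : ∀ r : ℝ, 0 < r → ∀ x, f (r • x) = r ^ 2 * f x)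
    {r : ℝ} (hr : 0 < r) (x : V) : generalizedHessian f (r • x) = generalizedHessian f x := by
  by_cases h : ∃ A, HasGeneralizedHessianAt f A x
  · obtain ⟨A, hA⟩ := h
    rw [hA.generalizedHessian_eq, (hA.smul hf hr).generalizedHessian_eq]
  · rw [generalizedHessian_eq_zero h, generalizedHessian_eq_zero]
    rintro ⟨A, hA⟩
    refine h ⟨A, ?_⟩
    have := hA.smul hf (inv_pos.2 hr)
    rwa [inv_smul_smul₀ hr.ne'] at this

end GeneralizedHessian

/-! ### Determinants of positive semidefinite maps -/

section Determinant

variable {V : Type*} [NormedAddCommGroup V] [InnerProductSpace ℝ V] [FiniteDimensional ℝ V]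

theorem LinearMap.IsPositive.det_nonneg' {A : V →ₗ[ℝ] V} (hA : A.IsPositive) :
    0 ≤ LinearMap.det A := by
  rw [hA.isSymmetric.det_eq_prod_eigenvalues rfl]
  exact Finset.prod_nonneg fun i _ => hA.nonneg_eigenvalues rfl i

/-- A crude substitute for the inequality between the geometric and arithmetic means of the
eigenvalues. -/
theorem LinearMap.IsPositive.det_rpow_le {A : V →ₗ[ℝ] V} (hA : A.IsPositive) :
    LinearMap.det A ^ (1 / ((Module.finrank ℝ V : ℝ) + 2)) ≤ 1 + LinearMap.trace ℝ V A := by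
  have htr := hA.isSymmetric.trace_eq_sum_eigenvalues (n := Module.finrank ℝ V) rfl
  simp only [RCLike.ofReal_real_eq_id] at htr
  have hev := hA.nonneg_eigenvalues (n := Module.finrank ℝ V) rfl
  have hT : 0 ≤ LinearMap.trace ℝ V A := by
    rw [htr]; exact Finset.sum_nonneg fun i _ => hev i
  have hle : ∀ i, hA.isSymmetric.eigenvalues rfl i ≤ LinearMap.trace ℝ V A := fun i => by
    rw [htr]
    exact Finset.single_le_sum (f := fun i => hA.isSymmetric.eigenvalues rfl i)
      (fun i _ => hev i) (Finset.mem_univ i)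
  have hdet : LinearMap.det A ≤ (1 + LinearMap.trace ℝ V A) ^ (Module.finrank ℝ V + 2) := by
    calc LinearMap.det A ≤ (LinearMap.trace ℝ V A) ^ (Module.finrank ℝ V) := by
          rw [hA.isSymmetric.det_eq_prod_eigenvalues rfl]
          refine (Finset.prod_le_prod (fun i _ => hev i) fun i _ => hle i).trans_eq ?_
          simp
      _ ≤ (1 + LinearMap.trace ℝ V A) ^ (Module.finrank ℝ V) := by gcongr; linarith
      _ ≤ _ := pow_le_pow_right₀ (by linarith) (by omega)
  calc _ ≤ ((1 + LinearMap.trace ℝ V A) ^ (Module.finrank ℝ V + 2)) ^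
        (1 / ((Module.finrank ℝ V : ℝ) + 2)) :=
        Real.rpow_le_rpow hA.det_nonneg' hdet (by positivity)
    _ = _ := by
      rw [← Real.rpow_natCast, ← Real.rpow_mul (by linarith)]
      push_cast
      rw [mul_one_div_cancel (by positivity), Real.rpow_one]

end Determinant

/-! ### Measurability of the generalized Hessian -/

section Measurability

variable {n : ℕ} {f : EuclideanSpace ℝ (Fin n) → ℝ}

/-- The upper limit of the second differences of `f` at `x` in direction `v`. -/
noncomputable def secondDifferenceLimsup (f : EuclideanSpace ℝ (Fin n) → ℝ)
    (v x : EuclideanSpace ℝ (Fin n)) : ℝ :=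
  limsup (fun k : ℕ => (f (x + (1 / ((k : ℝ) + 1)) • v) + f (x - (1 / ((k : ℝ) + 1)) • v) -
    2 * f x) / (1 / ((k : ℝ) + 1)) ^ 2) atTop

theorem tendsto_one_div_add_one_nhdsNE :
    Tendsto (fun k : ℕ => 1 / ((k : ℝ) + 1)) atTop (𝓝[≠] 0) :=
  tendsto_nhdsWithin_iff.2 ⟨tendsto_one_div_add_atTop_nhds_zero_nat,
    Eventually.of_forall fun k => by simp only [mem_compl_iff, mem_singleton_iff]; positivity⟩

theorem HasGeneralizedHessianAt.secondDifferenceLimsup_eq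
    {A : EuclideanSpace ℝ (Fin n) →ₗ[ℝ] EuclideanSpace ℝ (Fin n)} {x : EuclideanSpace ℝ (Fin n)}
    (h : HasGeneralizedHessianAt f A x) (v : EuclideanSpace ℝ (Fin n)) :
    secondDifferenceLimsup f v x = ⟪A v, v⟫ :=
  ((h.tendsto_secondDifference v).comp tendsto_one_div_add_one_nhdsNE).limsup_eq

theorem measurable_secondDifferenceLimsup (hf : Continuous f) (v : EuclideanSpace ℝ (Fin n)) :
    Measurable (secondDifferenceLimsup f v) := by
  refine Measurable.limsup fun k => Continuous.measurable ?_
  fun_prop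

/-- The matrix obtained by polarization from the upper limits of second differences. It represents
the generalized Hessian wherever that exists. -/
noncomputable def hessianMatrix (f : EuclideanSpace ℝ (Fin n) → ℝ)
    (x : EuclideanSpace ℝ (Fin n)) : Matrix (Fin n) (Fin n) ℝ :=
  Matrix.of fun i j => (1 / 2) * (secondDifferenceLimsup f
      (EuclideanSpace.basisFun (Fin n) ℝ i + EuclideanSpace.basisFun (Fin n) ℝ j) x -
    secondDifferenceLimsup f (EuclideanSpace.basisFun (Fin n) ℝ i) x -
    secondDifferenceLimsup f (EuclideanSpace.basisFun (Fin n) ℝ j) x)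

theorem HasGeneralizedHessianAt.eq_toEuclideanLin
    {A : EuclideanSpace ℝ (Fin n) →ₗ[ℝ] EuclideanSpace ℝ (Fin n)} {x : EuclideanSpace ℝ (Fin n)}
    (h : HasGeneralizedHessianAt f A x) : A = Matrix.toEuclideanLin (hessianMatrix f x) := by
  rw [Matrix.toEuclideanLin_eq_toLin_orthonormal, eq_comm, ← LinearEquiv.eq_symm_apply]
  ext i j
  rw [Matrix.toLin_symm, LinearMap.toMatrix_apply]
  simp only [hessianMatrix, Matrix.of_apply, h.secondDifferenceLimsup_eq]
  have hs := h.1 (EuclideanSpace.basisFun (Fin n) ℝ i) (EuclideanSpace.basisFun (Fin n) ℝ j)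
  rw [OrthonormalBasis.coe_toBasis, OrthonormalBasis.coe_toBasis_repr_apply,
    OrthonormalBasis.repr_apply_apply]
  rw [map_add, inner_add_left, inner_add_right, inner_add_right, hs,
    real_inner_comm (EuclideanSpace.basisFun (Fin n) ℝ i) (A (EuclideanSpace.basisFun (Fin n) ℝ j))]
  ring

theorem measurable_hessianMatrix_apply (hf : Continuous f) (i j : Fin n) :
    Measurable fun x => hessianMatrix f x i j :=
  (((measurable_secondDifferenceLimsup hf _).sub (measurable_secondDifferenceLimsup hf _)).sub
    (measurable_secondDifferenceLimsup hf _)).const_mul _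

/-- A generalized Hessian, if there is one, is represented by the measurable matrix function
`hessianMatrix`. By continuity the remainder of the expansion need only be controlled on a countable
dense set of increments. -/
theorem measurableSet_exists_hasGeneralizedHessianAt (hf : Continuous f) :
    MeasurableSet {x | ∃ A, HasGeneralizedHessianAt f A x} := by
  set r : EuclideanSpace ℝ (Fin n) → EuclideanSpace ℝ (Fin n) → ℝ := fun y x =>
    f (x + y) - f x - ⟪gradient f x, y⟫ -
      (1 / 2) * ⟪Matrix.toEuclideanLin (hessianMatrix f x) y, y⟫ with hr
  have hrm : ∀ y, Measurable (r y) := by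
    intro y
    refine (((hf.comp (by fun_prop)).measurable.sub hf.measurable).sub ?_).sub
      (Measurable.const_mul ?_ _)
    · simp only [inner_gradient_eq_fderiv]
      exact measurable_fderiv_apply_const ℝ f y
    · have : (fun x => ⟪Matrix.toEuclideanLin (hessianMatrix f x) y, y⟫) =
          fun x => ∑ i, (∑ j, hessianMatrix f x i j * y j) * y i := by
        ext x
        rw [PiLp.inner_apply]
        refine Finset.sum_congr rfl fun i _ => ?_
        simp [Matrix.ofLp_toLpLin, Matrix.mulVec, dotProduct, mul_comm]
      rw [this]
      exact Finset.measurable_sum _ fun i _ => (Finset.measurable_sum _ fun j _ =>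
        (measurable_hessianMatrix_apply hf i j).mul_const _).mul_const _
  have hrc : ∀ x, Continuous fun y => r y x := by
    intro x
    have : Continuous (Matrix.toEuclideanLin (hessianMatrix f x)) :=
      LinearMap.continuous_of_finiteDimensional _
    simp only [hr]
    fun_prop
  obtain ⟨D, hDc, hD⟩ := TopologicalSpace.exists_countable_dense (EuclideanSpace ℝ (Fin n))
  have hset : {x | ∃ A, HasGeneralizedHessianAt f A x} =
      ⋂ k : ℕ, ⋃ m : ℕ, ⋂ y ∈ D ∩ Metric.ball 0 (1 / ((m : ℝ) + 1)),
        {x | |r y x| ≤ 1 / ((k : ℝ) + 1) * ‖y‖ ^ 2} := by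
    ext x
    have hsymm : (Matrix.toEuclideanLin (hessianMatrix f x)).IsSymmetric := by
      rw [Matrix.isSymmetric_toEuclideanLin_iff]
      ext i j
      simp [hessianMatrix, add_comm]
      ring
    have h1 : (∃ A, HasGeneralizedHessianAt f A x) ↔
        (fun y => r y x) =o[𝓝 0] fun y => ‖y‖ ^ 2 := by
      constructor
      · rintro ⟨A, hA⟩
        have := hA.2
        rwa [hA.eq_toEuclideanLin] at this
      · exact fun h => ⟨_, hsymm, h⟩
    rw [mem_ofPred_eq, h1, isLittleO_iff]
    simp only [mem_iInter, mem_iUnion, mem_ofPred_eq]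
    constructor
    · intro h k
      obtain ⟨δ, hδ, hball⟩ := Metric.eventually_nhds_iff_ball.1
        (h (c := 1 / ((k : ℝ) + 1)) (by positivity))
      obtain ⟨m, hm⟩ := exists_nat_one_div_lt hδ
      refine ⟨m, fun y hy => ?_⟩
      have := hball y (Metric.ball_subset_ball hm.le hy.2)
      simpa using this
    · intro h c hc
      obtain ⟨k, hk⟩ := exists_nat_one_div_lt hc
      obtain ⟨m, hm⟩ := h k
      have hcl : IsClosed {y | |r y x| ≤ 1 / ((k : ℝ) + 1) * ‖y‖ ^ 2} :=
        isClosed_le (hrc x).abs (by fun_prop)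
      have hsub : Metric.ball 0 (1 / ((m : ℝ) + 1)) ⊆
          {y | |r y x| ≤ 1 / ((k : ℝ) + 1) * ‖y‖ ^ 2} := by
        refine (hD.open_subset_closure_inter Metric.isOpen_ball).trans ?_
        refine closure_minimal (fun y hy => hm y ⟨hy.2, hy.1⟩) hcl
      filter_upwards [Metric.ball_mem_nhds 0 (show (0 : ℝ) < 1 / ((m : ℝ) + 1) by positivity)]
        with y hy
      have := hsub hy
      rw [Real.norm_eq_abs, norm_pow, norm_norm]
      refine (show |r y x| ≤ _ from this).trans ?_
      gcongr
  rw [hset]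
  refine MeasurableSet.iInter fun k => MeasurableSet.iUnion fun m =>
    MeasurableSet.biInter (hDc.mono inter_subset_left) fun y _ => ?_
  exact measurableSet_le (hrm y).abs measurable_const

theorem measurable_det_generalizedHessian (hf : Continuous f) :
    Measurable fun x => LinearMap.det (generalizedHessian f x) := by
  classical
  have e : (fun x => LinearMap.det (generalizedHessian f x)) =
      {x | ∃ A, HasGeneralizedHessianAt f A x}.piecewise (fun x => (hessianMatrix f x).det)
        (fun _ => LinearMap.det (0 : EuclideanSpace ℝ (Fin n) →ₗ[ℝ] EuclideanSpace ℝ (Fin n))) := by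
    ext x
    by_cases h : ∃ A, HasGeneralizedHessianAt f A x
    · rw [piecewise_eq_of_mem _ _ _ (show x ∈ {x | ∃ A, HasGeneralizedHessianAt f A x} from h)]
      obtain ⟨A, hA⟩ := h
      rw [hA.generalizedHessian_eq, hA.eq_toEuclideanLin,
        Matrix.toEuclideanLin_eq_toLin_orthonormal,
        LinearMap.det_toLin]
    · rw [piecewise_eq_of_notMem _ _ _ (show x ∉ {x | ∃ A, HasGeneralizedHessianAt f A x} from h),
        generalizedHessian_eq_zero h]
  rw [e]
  refine Measurable.piecewise (measurableSet_exists_hasGeneralizedHessianAt hf) ?_ measurable_const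
  simp only [Matrix.det_apply]
  refine Finset.measurable_sum _ fun σ _ => Measurable.const_smul ?_ _
  exact Finset.measurable_prod _ fun i _ => measurable_hessianMatrix_apply hf _ _

end Measurability

/-! ### Local integrability of the generalized Laplacian -/

section Finiteness

open scoped ENNReal NNReal

variable {n : ℕ}

/-- Summation by parts: the integral of a second difference of a locally Lipschitz function against
a Lipschitz cut-off is of second order in the step. -/
theorem lintegral_secondDifference_le {f : EuclideanSpace ℝ (Fin n) → ℝ}
    (hf : ConvexOn ℝ univ f) (hfc : Continuous f) (e : EuclideanSpace ℝ (Fin n)) (he : ‖e‖ = 1)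
    (R : ℝ) {L : ℝ≥0} (hL : LipschitzOnWith L f (Metric.ball 0 (R + 4))) {t : ℝ}
    (ht : 0 < t) (ht1 : t ≤ 1) :
    ∫⁻ x in Metric.ball 0 R, ENNReal.ofReal ((f (x + t • e) + f (x - t • e) - 2 * f x) / t ^ 2) ≤
      ENNReal.ofReal (L * volume.real (Metric.ball (0 : EuclideanSpace ℝ (Fin n)) (R + 2))) := by
  -- a Lipschitz cut-off: at least `1` on the ball of radius `R`, and `0` outside that of radius `R + 1`
  set η : EuclideanSpace ℝ (Fin n) → ℝ := fun x => max 0 (R + 1 - ‖x‖) with hη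
  have hηc : Continuous η := by fun_prop
  have hη0 : ∀ x, 0 ≤ η x := fun x => le_max_left _ _
  have hη1 : ∀ x ∈ Metric.ball (0 : EuclideanSpace ℝ (Fin n)) R, 1 ≤ η x := fun x hx => by
    rw [mem_ball_zero_iff] at hx
    exact le_max_of_le_right (by linarith)
  have hηs : ∀ x, R + 1 ≤ ‖x‖ → η x = 0 := fun x hx => max_eq_left (by linarith)
  have hte : ‖t • e‖ = t := by rw [norm_smul, he, mul_one, Real.norm_of_nonneg ht.le]
  have hηsupp : HasCompactSupport η := by
    refine HasCompactSupport.intro (isCompact_closedBall 0 (R + 1)) fun x hx => hηs x ?_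
    rw [mem_closedBall_zero_iff, not_le] at hx
    exact hx.le
  set D : EuclideanSpace ℝ (Fin n) → ℝ := fun x => f (x + t • e) + f (x - t • e) - 2 * f x with hD
  have hDc : Continuous D := by
    simp only [hD]
    have h1 : Continuous fun x => f (x + t • e) := hfc.comp (by fun_prop)
    have h2 : Continuous fun x => f (x - t • e) := hfc.comp (by fun_prop)
    fun_prop
  have hD0 : ∀ x, 0 ≤ D x := by
    intro x
    have := hf.2 (mem_univ (x + t • e)) (mem_univ (x - t • e)) (by norm_num : (0 : ℝ) ≤ 1 / 2)
      (by norm_num : (0 : ℝ) ≤ 1 / 2) (by norm_num)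
    have e : (1 / 2 : ℝ) • (x + t • e) + (1 / 2 : ℝ) • (x - t • e) = x := by module
    rw [e, smul_eq_mul, smul_eq_mul] at this
    simp only [hD]; linarith
  -- the product of the first differences of `f` and of the cut-off
  set P : EuclideanSpace ℝ (Fin n) → ℝ := fun x => (f (x + t • e) - f x) * (η x - η (x + t • e))
    with hP
  have hint : ∫ x, η x * D x = ∫ x, P x := by
    have i1 : Integrable fun x => η x * (f (x + t • e) - f x) := by
      refine Continuous.integrable_of_hasCompactSupport ?_ hηsupp.mul_right
      have h1 : Continuous fun x => f (x + t • e) := hfc.comp (by fun_prop)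
      fun_prop
    have i2 : Integrable fun x => η x * (f x - f (x - t • e)) := by
      refine Continuous.integrable_of_hasCompactSupport ?_ hηsupp.mul_right
      have h1 : Continuous fun x => f (x - t • e) := hfc.comp (by fun_prop)
      fun_prop
    have i3 : Integrable fun x => η (x + t • e) * (f (x + t • e) - f x) := by
      have := i2.comp_add_right (t • e)
      simpa using this
    have e3 : ∫ x, η (x + t • e) * (f (x + t • e) - f x) = ∫ x, η x * (f x - f (x - t • e)) := by
      have := integral_add_right_eq_self (μ := (volume : Measure (EuclideanSpace ℝ (Fin n))))
        (fun x => η x * (f x - f (x - t • e))) (t • e)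
      simpa using this
    calc ∫ x, η x * D x
        = ∫ x, (η x * (f (x + t • e) - f x) - η x * (f x - f (x - t • e))) := by
          refine integral_congr_ae (Eventually.of_forall fun x => ?_)
          simp only [hD]; ring
      _ = ∫ x, P x := by
          rw [integral_sub i1 i2, ← e3, ← integral_sub i1 i3]
          refine integral_congr_ae (Eventually.of_forall fun x => ?_)
          simp only [hP]; ring
  have hPle : ∀ x, ‖P x‖ ≤ (Metric.ball (0 : EuclideanSpace ℝ (Fin n)) (R + 2)).indicator
      (fun _ => L * t ^ 2) x := by
    intro x
    by_cases hx : x ∈ Metric.ball (0 : EuclideanSpace ℝ (Fin n)) (R + 2)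
    · rw [indicator_of_mem hx]
      rw [mem_ball_zero_iff] at hx
      have hx' : ‖x + t • e‖ < R + 4 := by
        have := norm_add_le x (t • e)
        rw [hte] at this
        linarith
      have h1 := hL.dist_le_mul (x + t • e) (by rwa [mem_ball_zero_iff]) x
        (by rw [mem_ball_zero_iff]; linarith)
      rw [dist_eq_norm, dist_eq_norm, add_sub_cancel_left, hte] at h1
      have h2 : |η x - η (x + t • e)| ≤ t := by
        simp only [hη]
        refine (abs_max_sub_max_le_max _ _ _ _).trans ?_
        rw [sub_self, abs_zero]
        refine max_le ht.le ?_
        have e1 : R + 1 - ‖x‖ - (R + 1 - ‖x + t • e‖) = ‖x + t • e‖ - ‖x‖ := by ring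
        rw [e1]
        refine (abs_norm_sub_norm_le _ _).trans ?_
        rw [add_sub_cancel_left, hte]
      rw [norm_mul, Real.norm_eq_abs (η x - η (x + t • e))]
      calc _ ≤ L * t * t := by gcongr
        _ = _ := by ring
    · rw [indicator_of_notMem hx]
      rw [mem_ball_zero_iff, not_lt] at hx
      have h1 : η x = 0 := hηs x (by linarith)
      have h2 : η (x + t • e) = 0 := by
        refine hηs _ ?_
        have := norm_sub_norm_le x (-(t • e))
        rw [sub_neg_eq_add, norm_neg, hte] at this
        linarith
      simp [hP, h1, h2]
  have hbound : ∫ x, η x * D x ≤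
      L * t ^ 2 * volume.real (Metric.ball (0 : EuclideanSpace ℝ (Fin n)) (R + 2)) := by
    rw [hint]
    have i4 : Integrable ((Metric.ball (0 : EuclideanSpace ℝ (Fin n)) (R + 2)).indicator
        (fun _ => (L : ℝ) * t ^ 2)) :=
      (integrable_indicator_iff measurableSet_ball).2 (integrableOn_const (by
        exact measure_ball_lt_top.ne))
    refine (le_abs_self _).trans ((norm_integral_le_of_norm_le i4
      (Eventually.of_forall hPle)).trans_eq ?_)
    rw [integral_indicator measurableSet_ball, setIntegral_const, smul_eq_mul, mul_comm]
  have hi : Integrable fun x => η x * D x :=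
    (hηc.mul hDc).integrable_of_hasCompactSupport hηsupp.mul_right
  calc ∫⁻ x in Metric.ball 0 R, ENNReal.ofReal (D x / t ^ 2)
      ≤ ∫⁻ x in Metric.ball 0 R, ENNReal.ofReal (η x * D x / t ^ 2) := by
        refine setLIntegral_mono' measurableSet_ball fun x hx => ?_
        refine ENNReal.ofReal_le_ofReal ?_
        gcongr
        nlinarith [hη1 x hx, hD0 x]
    _ ≤ ∫⁻ x, ENNReal.ofReal (η x * D x / t ^ 2) := setLIntegral_le_lintegral _ _
    _ = ENNReal.ofReal ((∫ x, η x * D x) / t ^ 2) := by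
        rw [← integral_div, ofReal_integral_eq_lintegral_ofReal (hi.div_const _)]
        exact Eventually.of_forall fun x => div_nonneg (mul_nonneg (hη0 x) (hD0 x)) (sq_nonneg t)
    _ ≤ _ := by
        refine ENNReal.ofReal_le_ofReal ?_
        rw [div_le_iff₀ (by positivity)]
        linarith

theorem measurable_inner_generalizedHessian {f : EuclideanSpace ℝ (Fin n) → ℝ}
    (hf : Continuous f) (v : EuclideanSpace ℝ (Fin n)) :
    Measurable fun x => ⟪generalizedHessian f x v, v⟫ := by
  classical
  have e : (fun x => ⟪generalizedHessian f x v, v⟫) =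
      {x | ∃ A, HasGeneralizedHessianAt f A x}.piecewise (secondDifferenceLimsup f v)
        (fun _ => 0) := by
    ext x
    by_cases h : ∃ A, HasGeneralizedHessianAt f A x
    · rw [piecewise_eq_of_mem _ _ _ (show x ∈ {x | ∃ A, HasGeneralizedHessianAt f A x} from h),
        (hasGeneralizedHessianAt_generalizedHessian h).secondDifferenceLimsup_eq]
    · rw [piecewise_eq_of_notMem _ _ _ (show x ∉ {x | ∃ A, HasGeneralizedHessianAt f A x} from h),
        generalizedHessian_eq_zero h]
      simp
  rw [e]
  exact Measurable.piecewise (measurableSet_exists_hasGeneralizedHessianAt hf)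
    (measurable_secondDifferenceLimsup hf v) measurable_const

/-- The second directional derivatives of a convex function are locally integrable, by Fatou's lemma
and the uniform bound on the integrals of the second difference quotients. -/
theorem lintegral_inner_generalizedHessian_lt_top {f : EuclideanSpace ℝ (Fin n) → ℝ}
    (hf : ConvexOn ℝ univ f) (hfc : Continuous f) (e : EuclideanSpace ℝ (Fin n)) (he : ‖e‖ = 1)
    (R : ℝ) {L : ℝ≥0} (hL : LipschitzOnWith L f (Metric.ball 0 (R + 4))) :
    ∫⁻ x in Metric.ball 0 R, ENNReal.ofReal ⟪generalizedHessian f x e, e⟫ < ∞ := by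
  have hm : ∀ k : ℕ, Measurable fun x : EuclideanSpace ℝ (Fin n) =>
      ENNReal.ofReal ((f (x + (1 / ((k : ℝ) + 1)) • e) +
        f (x - (1 / ((k : ℝ) + 1)) • e) - 2 * f x) / (1 / ((k : ℝ) + 1)) ^ 2) := by
    intro k
    refine Measurable.ennreal_ofReal (Continuous.measurable ?_)
    have h1 : Continuous fun x => f (x + (1 / ((k : ℝ) + 1)) • e) := hfc.comp (by fun_prop)
    have h2 : Continuous fun x => f (x - (1 / ((k : ℝ) + 1)) • e) := hfc.comp (by fun_prop)
    fun_prop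
  have hle : ∀ x, ENNReal.ofReal ⟪generalizedHessian f x e, e⟫ ≤
      liminf (fun k : ℕ => ENNReal.ofReal ((f (x + (1 / ((k : ℝ) + 1)) • e) +
        f (x - (1 / ((k : ℝ) + 1)) • e) - 2 * f x) / (1 / ((k : ℝ) + 1)) ^ 2)) atTop := by
    intro x
    by_cases h : ∃ A, HasGeneralizedHessianAt f A x
    · have h1 := (hasGeneralizedHessianAt_generalizedHessian h).tendsto_secondDifference e
      have h2 := (ENNReal.continuous_ofReal.tendsto _).comp (h1.comp tendsto_one_div_add_one_nhdsNE)
      exact h2.liminf_eq.ge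
    · rw [generalizedHessian_eq_zero h]
      simp
  calc _ ≤ ∫⁻ x in Metric.ball 0 R, liminf (fun k : ℕ => ENNReal.ofReal
        ((f (x + (1 / ((k : ℝ) + 1)) • e) +
        f (x - (1 / ((k : ℝ) + 1)) • e) - 2 * f x) / (1 / ((k : ℝ) + 1)) ^ 2)) atTop :=
        lintegral_mono hle
    _ ≤ liminf (fun k : ℕ => ∫⁻ x in Metric.ball 0 R, ENNReal.ofReal
        ((f (x + (1 / ((k : ℝ) + 1)) • e) +
        f (x - (1 / ((k : ℝ) + 1)) • e) - 2 * f x) / (1 / ((k : ℝ) + 1)) ^ 2)) atTop :=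
        lintegral_liminf_le hm
    _ ≤ ENNReal.ofReal (L * volume.real (Metric.ball (0 : EuclideanSpace ℝ (Fin n)) (R + 2))) := by
        refine liminf_le_of_le (by isBoundedDefault) fun b hb => ?_
        obtain ⟨k, hk⟩ := hb.exists
        refine hk.trans (lintegral_secondDifference_le hf hfc e he R hL (by positivity) ?_)
        rw [div_le_one (by positivity)]
        linarith [Nat.cast_nonneg (α := ℝ) k]
    _ < ∞ := ENNReal.ofReal_lt_top

/-- The affine surface area density of a convex function is integrable over balls: it is controlled
by the generalized Laplacian, which is bounded by integrals of second differences. -/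
theorem lintegral_det_generalizedHessian_lt_top {f : EuclideanSpace ℝ (Fin n) → ℝ}
    (hf : ConvexOn ℝ univ f) (hfc : Continuous f)
    (R : ℝ) {L : ℝ≥0} (hL : LipschitzOnWith L f (Metric.ball 0 (R + 4))) :
    ∫⁻ x in Metric.ball 0 R, ENNReal.ofReal
      (LinearMap.det (generalizedHessian f x) ^ (1 / ((n : ℝ) + 2))) < ∞ := by
  set b := EuclideanSpace.basisFun (Fin n) ℝ with hb
  have hle : ∀ x, ENNReal.ofReal
      (LinearMap.det (generalizedHessian f x) ^ (1 / ((n : ℝ) + 2))) ≤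
      1 + ∑ i, ENNReal.ofReal ⟪generalizedHessian f x (b i), b i⟫ := by
    intro x
    have hpos : (generalizedHessian f x).IsPositive := by
      by_cases h : ∃ A, HasGeneralizedHessianAt f A x
      · exact hf.isPositive_of_hasGeneralizedHessianAt (hasGeneralizedHessianAt_generalizedHessian h)
      · rw [generalizedHessian_eq_zero h]; exact LinearMap.isPositive_zero
    have h1 := hpos.det_rpow_le
    rw [finrank_euclideanSpace_fin, LinearMap.trace_eq_sum_inner _ b] at h1
    refine (ENNReal.ofReal_le_ofReal h1).trans ?_
    refine ENNReal.ofReal_add_le.trans ?_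
    rw [ENNReal.ofReal_one]
    gcongr
    rw [ENNReal.ofReal_sum_of_nonneg (fun i _ => hpos.inner_nonneg_right _)]
    refine Finset.sum_le_sum fun i _ => ?_
    rw [real_inner_comm]
  refine (lintegral_mono hle).trans_lt ?_
  rw [lintegral_add_left measurable_const, lintegral_finsetSum _ fun i _ =>
    (measurable_inner_generalizedHessian hfc (b i)).ennreal_ofReal]
  refine ENNReal.add_lt_top.2 ⟨?_, ENNReal.sum_lt_top.2 fun i _ =>
    lintegral_inner_generalizedHessian_lt_top hf hfc (b i) (b.norm_eq_one i) R hL⟩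
  simp [measure_ball_lt_top]

end Finiteness

/-! ### Extending a quadratic form from a hyperplane -/

section ObliqueDecomposition

variable {V : Type*} [NormedAddCommGroup V] [InnerProductSpace ℝ V]

/-- The orthogonal decomposition of a vector along a unit vector `N`. -/
noncomputable def orthogonalSplit (N : V) (hN : ‖N‖ = 1) :
    V ≃ₗ[ℝ] (Submodule.span ℝ {N})ᗮ × ℝ where
  toFun v := ((Submodule.span ℝ {N})ᗮ.orthogonalProjectionOnto v, ⟪v, N⟫)
  map_add' v w := by simp [inner_add_left]
  map_smul' c v := by simp [real_inner_smul_left]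
  invFun p := (p.1 : V) + p.2 • N
  left_inv v := by
    have h1 := (Submodule.span ℝ {N}).starProjection_add_starProjection_orthogonal v
    rw [Submodule.starProjection_unit_singleton ℝ hN] at h1
    rw [add_comm, real_inner_comm] at h1
    exact h1
  right_inv p := by
    have h1 : ⟪(p.1 : V), N⟫ = 0 := Submodule.mem_orthogonal_singleton_iff_inner_left.1 p.1.2
    have h2 : (Submodule.span ℝ {N})ᗮ.orthogonalProjectionOnto N = 0 :=
      Submodule.orthogonalProjectionOnto_orthogonal_apply_eq_zero (Submodule.mem_span_singleton_self N)
    ext1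
    · simp [h2]
    · simp [inner_add_left, real_inner_smul_left, h1, hN]

/-- The endomorphism acting as `B` on the orthogonal complement of the unit vector `N`, and fixing
`N`. -/
noncomputable def extendByNormal (N : V) (hN : ‖N‖ = 1)
    (B : (Submodule.span ℝ {N})ᗮ →ₗ[ℝ] (Submodule.span ℝ {N})ᗮ) : V →ₗ[ℝ] V :=
  (orthogonalSplit N hN).symm.toLinearMap ∘ₗ (B.prodMap LinearMap.id) ∘ₗ
    (orthogonalSplit N hN).toLinearMap

theorem inner_extendByNormal (N : V) (hN : ‖N‖ = 1)
    (B : (Submodule.span ℝ {N})ᗮ →ₗ[ℝ] (Submodule.span ℝ {N})ᗮ) (v w : V) :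
    ⟪extendByNormal N hN B v, w⟫ =
      ⟪B ((Submodule.span ℝ {N})ᗮ.orthogonalProjectionOnto v),
        (Submodule.span ℝ {N})ᗮ.orthogonalProjectionOnto w⟫ + ⟪v, N⟫ * ⟪w, N⟫ := by
  have : extendByNormal N hN B v =
      (B ((Submodule.span ℝ {N})ᗮ.orthogonalProjectionOnto v) : V) + ⟪v, N⟫ • N := rfl
  rw [this, inner_add_left, real_inner_smul_left, real_inner_comm N w,
    Submodule.inner_orthogonalProjectionOnto_eq_of_mem_left]

/-- The linear map that fixes the orthogonal complement of `N` and sends `z` to `N`. -/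
noncomputable def shearToNormal (N z : V) : V →ₗ[ℝ] V :=
  LinearMap.transvection ((⟪z, N⟫⁻¹ : ℝ) • (innerₛₗ ℝ N : V →ₗ[ℝ] ℝ)) (N - z)

theorem shearToNormal_apply (N z v : V) :
    shearToNormal N z v = v + (⟪v, N⟫ / ⟪z, N⟫) • (N - z) := by
  rw [shearToNormal, LinearMap.transvection.apply]
  simp [real_inner_comm, div_eq_inv_mul]

theorem inner_shearToNormal {N z : V} (hN : ‖N‖ = 1) (hz : ⟪z, N⟫ ≠ 0) (v : V) :
    ⟪shearToNormal N z v, N⟫ = ⟪v, N⟫ / ⟪z, N⟫ := by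
  have hNN : ⟪N, N⟫ = 1 := by rw [real_inner_self_eq_norm_sq, hN, one_pow]
  rw [shearToNormal_apply, inner_add_left, real_inner_smul_left, inner_sub_left, hNN]
  field_simp
  ring

theorem coe_orthogonalProjectionOnto_shearToNormal {N z : V} (hN : ‖N‖ = 1) (hz : ⟪z, N⟫ ≠ 0)
    (v : V) : ((Submodule.span ℝ {N})ᗮ.orthogonalProjectionOnto (shearToNormal N z v) : V) =
      v - (⟪v, N⟫ / ⟪z, N⟫) • z := by
  have h1 := (orthogonalSplit N hN).symm_apply_apply (shearToNormal N z v)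
  have h2 : ((Submodule.span ℝ {N})ᗮ.orthogonalProjectionOnto (shearToNormal N z v) : V) +
      ⟪shearToNormal N z v, N⟫ • N = shearToNormal N z v := h1
  rw [inner_shearToNormal hN hz] at h2
  rw [eq_sub_of_add_eq h2, shearToNormal_apply]
  module

variable [FiniteDimensional ℝ V]

theorem det_extendByNormal (N : V) (hN : ‖N‖ = 1)
    (B : (Submodule.span ℝ {N})ᗮ →ₗ[ℝ] (Submodule.span ℝ {N})ᗮ) :
    LinearMap.det (extendByNormal N hN B) = LinearMap.det B := by
  have h := LinearMap.det_conj (B.prodMap (LinearMap.id : ℝ →ₗ[ℝ] ℝ)) (orthogonalSplit N hN).symm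
  rw [LinearEquiv.symm_symm, LinearMap.det_prodMap, LinearMap.det_id, mul_one] at h
  exact h

theorem det_adjoint_real (S : V →ₗ[ℝ] V) :
    LinearMap.det (LinearMap.adjoint S) = LinearMap.det S := by
  have b := stdOrthonormalBasis ℝ V
  rw [← LinearMap.det_toMatrix b.toBasis, LinearMap.toMatrix_adjoint,
    ← LinearMap.det_toMatrix b.toBasis,
    Matrix.det_conjTranspose, star_trivial]

theorem det_shearToNormal {N z : V} (hN : ‖N‖ = 1) (hz : ⟪z, N⟫ ≠ 0) :
    LinearMap.det (shearToNormal N z) = ⟪z, N⟫⁻¹ := by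
  have hNN : ⟪N, N⟫ = 1 := by rw [real_inner_self_eq_norm_sq, hN, one_pow]
  rw [shearToNormal, LinearMap.transvection.det]
  simp only [LinearMap.smul_apply, innerₛₗ_apply_apply, inner_sub_right, hNN, real_inner_comm z N,
    smul_eq_mul]
  field_simp
  ring

/-- The symmetric endomorphism with quadratic form
`v ↦ (⟪v, N⟫ / ⟪z, N⟫) ^ 2 + ⟪B y, y⟫`, where `y = v - (⟪v, N⟫ / ⟪z, N⟫) • z`. -/
noncomputable def obliqueExtension (N z : V) (hN : ‖N‖ = 1)
    (B : (Submodule.span ℝ {N})ᗮ →ₗ[ℝ] (Submodule.span ℝ {N})ᗮ) : V →ₗ[ℝ] V :=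
  LinearMap.adjoint (shearToNormal N z) ∘ₗ extendByNormal N hN B ∘ₗ shearToNormal N z

theorem inner_obliqueExtension {N z : V} (hN : ‖N‖ = 1) (hz : ⟪z, N⟫ ≠ 0)
    (B : (Submodule.span ℝ {N})ᗮ →ₗ[ℝ] (Submodule.span ℝ {N})ᗮ) (v w : V) :
    ⟪obliqueExtension N z hN B v, w⟫ =
      ⟪B ((Submodule.span ℝ {N})ᗮ.orthogonalProjectionOnto (shearToNormal N z v)),
        (Submodule.span ℝ {N})ᗮ.orthogonalProjectionOnto (shearToNormal N z w)⟫ +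
      (⟪v, N⟫ / ⟪z, N⟫) * (⟪w, N⟫ / ⟪z, N⟫) := by
  rw [obliqueExtension, LinearMap.comp_apply, LinearMap.comp_apply, LinearMap.adjoint_inner_left,
    inner_extendByNormal, inner_shearToNormal hN hz, inner_shearToNormal hN hz]

theorem isSymmetric_obliqueExtension {N z : V} (hN : ‖N‖ = 1) (hz : ⟪z, N⟫ ≠ 0)
    {B : (Submodule.span ℝ {N})ᗮ →ₗ[ℝ] (Submodule.span ℝ {N})ᗮ} (hB : B.IsSymmetric) :
    (obliqueExtension N z hN B).IsSymmetric := by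
  intro v w
  rw [inner_obliqueExtension hN hz, real_inner_comm (obliqueExtension N z hN B w),
    inner_obliqueExtension hN hz, hB,
    real_inner_comm, mul_comm]

theorem det_obliqueExtension {N z : V} (hN : ‖N‖ = 1) (hz : ⟪z, N⟫ ≠ 0)
    (B : (Submodule.span ℝ {N})ᗮ →ₗ[ℝ] (Submodule.span ℝ {N})ᗮ) :
    LinearMap.det (obliqueExtension N z hN B) = ⟪z, N⟫⁻¹ ^ 2 * LinearMap.det B := by
  rw [obliqueExtension, LinearMap.det_comp, LinearMap.det_comp, det_adjoint_real,
    det_extendByNormal, det_shearToNormal hN hz]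
  ring

theorem isBigO_inner_map_self (B : V →ₗ[ℝ] V) :
    (fun y : V => ⟪B y, y⟫) =O[𝓝 0] fun y => ‖y‖ ^ 2 := by
  obtain ⟨C, hC⟩ : ∃ C, ∀ y, ‖B y‖ ≤ C * ‖y‖ := ⟨_, (LinearMap.toContinuousLinearMap B).le_opNorm⟩
  refine IsBigO.of_bound C (Eventually.of_forall fun y => ?_)
  refine (norm_inner_le_norm _ _).trans ?_
  rw [norm_pow, norm_norm, sq, ← mul_assoc]
  exact mul_le_mul_of_nonneg_right (hC y) (norm_nonneg y)

end ObliqueDecomposition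

/-- Asymptotically equivalent functions have the same second order expansions. -/
theorem isLittleO_sub_of_isEquivalent {α : Type*} {l : Filter α} {u w q k : α → ℝ}
    (huw : u ~[l] w) (hq : q =O[l] k) (h : (fun x => u x - q x) =o[l] k) :
    (fun x => w x - q x) =o[l] k := by
  have h1 : u =O[l] k := by
    refine (h.isBigO.add hq).congr_left fun x => ?_
    ring
  have h2 : (fun x => w x - u x) =o[l] k := huw.symm.isLittleO.trans_isBigO h1
  refine (h2.add h).congr_left fun x => ?_
  ring

/-! ### The local graph of the boundary -/

section LocalGraph

variable {n : ℕ} {K : Set (EuclideanSpace ℝ (Fin n))} {z : EuclideanSpace ℝ (Fin n)}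

theorem norm_outerUnitNormal (hc : Convex ℝ K) (h0 : K ∈ 𝓝 0) (hcl : IsClosed K)
    (h : DifferentiableAt ℝ (gauge K) z) (hz : gauge K z = 1) : ‖outerUnitNormal K z‖ = 1 :=
  ((isOuterUnitNormal_iff_of_differentiableAt hc h0 hcl h hz _).2
    (outerUnitNormal_eq hc h0 hcl h hz)).1

theorem inner_outerUnitNormal_pos (hc : Convex ℝ K) (h0 : K ∈ 𝓝 0) (hcl : IsClosed K)
    (h : DifferentiableAt ℝ (gauge K) z) (hz : gauge K z = 1) : 0 < ⟪z, outerUnitNormal K z⟫ := by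
  rw [inner_outerUnitNormal hc h0 hcl h hz]
  exact inv_pos.2 (norm_pos_iff.2 (gradient_gauge_ne_zero h hz))

theorem fderiv_gauge_apply (hc : Convex ℝ K) (h0 : K ∈ 𝓝 0) (hcl : IsClosed K)
    (h : DifferentiableAt ℝ (gauge K) z) (hz : gauge K z = 1) (v : EuclideanSpace ℝ (Fin n)) :
    fderiv ℝ (gauge K) z v = ⟪v, outerUnitNormal K z⟫ / ⟪z, outerUnitNormal K z⟫ := by
  have hne := norm_ne_zero_iff.2 (gradient_gauge_ne_zero h hz)
  rw [inner_outerUnitNormal hc h0 hcl h hz, outerUnitNormal_eq hc h0 hcl h hz,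
    real_inner_smul_right, real_inner_comm, inner_gradient_eq_fderiv]
  field_simp

theorem localGraph_zero (hc : Convex ℝ K) (h0 : K ∈ 𝓝 0) (hcl : IsClosed K)
    (h : DifferentiableAt ℝ (gauge K) z) (hz : gauge K z = 1) : localGraph K z 0 = 0 := by
  have hex := (isOuterUnitNormal_iff_of_differentiableAt hc h0 hcl h hz _).2
    (outerUnitNormal_eq hc h0 hcl h hz)
  refine IsLeast.csInf_eq ⟨?_, fun t ht => ?_⟩
  · simp only [ZeroMemClass.coe_zero, add_zero, mem_ofPred_eq, zero_smul, sub_zero]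
    rw [← hcl.closure_eq, ← gauge_le_one_iff_mem_closure hc h0, hz]
  · have := hex.2 _ ht
    simp only [ZeroMemClass.coe_zero, add_zero] at this
    rw [sub_sub_cancel_left, inner_neg_left, real_inner_smul_left, real_inner_self_eq_norm_sq,
      hex.1] at this
    linarith

theorem nonneg_of_mem_localGraph (hc : Convex ℝ K) (h0 : K ∈ 𝓝 0) (hcl : IsClosed K)
    (h : DifferentiableAt ℝ (gauge K) z) (hz : gauge K z = 1)
    (y : (Submodule.span ℝ {outerUnitNormal K z})ᗮ) {t : ℝ}
    (ht : z + (y : EuclideanSpace ℝ (Fin n)) - t • outerUnitNormal K z ∈ K) : 0 ≤ t := by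
  have hex := (isOuterUnitNormal_iff_of_differentiableAt hc h0 hcl h hz _).2
    (outerUnitNormal_eq hc h0 hcl h hz)
  have h1 : ⟪(y : EuclideanSpace ℝ (Fin n)), outerUnitNormal K z⟫ = 0 :=
    Submodule.mem_orthogonal_singleton_iff_inner_left.1 y.2
  have := hex.2 _ ht
  rw [add_sub_assoc, add_sub_cancel_left, inner_sub_left, h1, real_inner_smul_left,
    real_inner_self_eq_norm_sq, hex.1] at this
  linarith

theorem localGraph_nonneg (hc : Convex ℝ K) (h0 : K ∈ 𝓝 0) (hcl : IsClosed K)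
    (h : DifferentiableAt ℝ (gauge K) z) (hz : gauge K z = 1)
    (y : (Submodule.span ℝ {outerUnitNormal K z})ᗮ) : 0 ≤ localGraph K z y :=
  Real.sInf_nonneg fun _ ht => nonneg_of_mem_localGraph hc h0 hcl h hz y ht

theorem tendsto_add_coe_nhds (z N : EuclideanSpace ℝ (Fin n)) :
    Tendsto (fun y : (Submodule.span ℝ {N})ᗮ => z + (y : EuclideanSpace ℝ (Fin n))) (𝓝 0) (𝓝 z) := by
  have : Continuous fun y : (Submodule.span ℝ {N})ᗮ => z + (y : EuclideanSpace ℝ (Fin n)) := by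
    fun_prop
  simpa using this.tendsto 0

/-- Every small positive depth is eventually reached by the body. -/
theorem eventually_mem_localGraph (hc : Convex ℝ K) (h0 : K ∈ 𝓝 0) (hcl : IsClosed K)
    (h : DifferentiableAt ℝ (gauge K) z) (hz : gauge K z = 1) {ε : ℝ} (hε : 0 < ε) :
    ∃ t, 0 < t ∧ t < ε ∧ ∀ᶠ y : (Submodule.span ℝ {outerUnitNormal K z})ᗮ in 𝓝 0,
      z + (y : EuclideanSpace ℝ (Fin n)) - t • outerUnitNormal K z ∈ K := by
  set N := outerUnitNormal K z with hN
  have hN1 := norm_outerUnitNormal hc h0 hcl h hz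
  have hh := inner_outerUnitNormal_pos hc h0 hcl h hz
  rw [← hN] at hN1 hh
  have h3 : HasDerivAt (fun t : ℝ => z - t • N) (-N) 0 := by
    simpa using ((hasDerivAt_id (0 : ℝ)).smul_const N).const_sub z
  have h2 : HasFDerivAt (gauge K) (fderiv ℝ (gauge K) z) (z - (0 : ℝ) • N) := by
    simpa using h.hasFDerivAt
  have hd := h2.comp_hasDerivAt 0 h3
  rw [map_neg, fderiv_gauge_apply hc h0 hcl h hz, ← hN, real_inner_self_eq_norm_sq, hN1] at hd
  have hlim := hd.tendsto_slope_zero_right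
  have hneg : ∀ᶠ t : ℝ in 𝓝[>] 0, t⁻¹ • ((gauge K ∘ fun t : ℝ => z - t • N) (0 + t) -
      (gauge K ∘ fun t : ℝ => z - t • N) 0) < 0 :=
    hlim.eventually_lt_const (by
      rw [neg_lt_zero]; positivity)
  obtain ⟨t, ht, ht0, htε⟩ := (hneg.and (Ioo_mem_nhdsGT hε)).exists
  have hlt : gauge K (z - t • N) < 1 := by
    simp only [Function.comp, zero_add, zero_smul, sub_zero, hz, smul_eq_mul] at ht
    have := (inv_mul_lt_iff₀ ht0).1 ht
    linarith
  refine ⟨t, ht0, htε, ?_⟩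
  have hmem : interior K ∈ 𝓝 (z - t • N) :=
    isOpen_interior.mem_nhds ((gauge_lt_one_iff_mem_interior hc h0).1 hlt)
  have hten : Tendsto (fun y : (Submodule.span ℝ {N})ᗮ =>
      z + (y : EuclideanSpace ℝ (Fin n)) - t • N) (𝓝 0) (𝓝 (z - t • N)) :=
    (tendsto_add_coe_nhds z N).sub_const _
  filter_upwards [hten hmem] with y hy using interior_subset hy

theorem bddBelow_localGraph (hc : Convex ℝ K) (h0 : K ∈ 𝓝 0) (hcl : IsClosed K)
    (h : DifferentiableAt ℝ (gauge K) z) (hz : gauge K z = 1)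
    (y : (Submodule.span ℝ {outerUnitNormal K z})ᗮ) :
    BddBelow {t : ℝ | z + (y : EuclideanSpace ℝ (Fin n)) - t • outerUnitNormal K z ∈ K} :=
  ⟨0, fun _ ht => nonneg_of_mem_localGraph hc h0 hcl h hz y ht⟩

/-- The local graph function is continuous at `0`. -/
theorem tendsto_localGraph (hc : Convex ℝ K) (h0 : K ∈ 𝓝 0) (hcl : IsClosed K)
    (h : DifferentiableAt ℝ (gauge K) z) (hz : gauge K z = 1) :
    Tendsto (localGraph K z) (𝓝 0) (𝓝 0) := by
  rw [Metric.tendsto_nhds]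
  intro ε hε
  obtain ⟨t, _, htε, hev⟩ := eventually_mem_localGraph hc h0 hcl h hz hε
  filter_upwards [hev] with y hy
  rw [Real.dist_0_eq_abs, abs_of_nonneg (localGraph_nonneg hc h0 hcl h hz y)]
  exact (csInf_le (bddBelow_localGraph hc h0 hcl h hz y) hy).trans_lt htε

/-- Near `0` the local graph describes boundary points of `K`. -/
theorem eventually_gauge_localGraph (hc : Convex ℝ K) (h0 : K ∈ 𝓝 0) (hcl : IsClosed K)
    (h : DifferentiableAt ℝ (gauge K) z) (hz : gauge K z = 1) :
    ∀ᶠ y : (Submodule.span ℝ {outerUnitNormal K z})ᗮ in 𝓝 0,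
      gauge K (z + (y : EuclideanSpace ℝ (Fin n)) - localGraph K z y • outerUnitNormal K z) = 1 := by
  obtain ⟨t, _, _, hev⟩ := eventually_mem_localGraph hc h0 hcl h hz one_pos
  filter_upwards [hev] with y hy
  have hcont : Continuous fun t : ℝ =>
      z + (y : EuclideanSpace ℝ (Fin n)) - t • outerUnitNormal K z := by fun_prop
  have hbdd := bddBelow_localGraph hc h0 hcl h hz y
  have hmem := (hcl.preimage hcont).csInf_mem ⟨t, hy⟩ hbdd
  refine le_antisymm (gauge_le_one_of_mem hmem) (not_lt.1 fun hlt => ?_)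
  -- otherwise the minimal depth could be lowered
  have hopen : IsOpen {t : ℝ | gauge K (z + (y : EuclideanSpace ℝ (Fin n)) -
      t • outerUnitNormal K z) < 1} :=
    isOpen_lt ((continuous_gauge hc h0).comp hcont) continuous_const
  obtain ⟨δ, hδ, hball⟩ := Metric.isOpen_iff.1 hopen _ hlt
  have h1 : localGraph K z y - δ / 2 ∈ Metric.ball (localGraph K z y) δ := by
    rw [mem_ball_iff_norm, Real.norm_eq_abs, sub_sub_cancel_left, abs_neg, abs_of_pos (by positivity)]
    linarith
  have h2 : z + (y : EuclideanSpace ℝ (Fin n)) -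
      (localGraph K z y - δ / 2) • outerUnitNormal K z ∈ K :=
    interior_subset ((gauge_lt_one_iff_mem_interior hc h0).1 (hball h1))
  have h3 : localGraph K z y ≤ localGraph K z y - δ / 2 := csInf_le hbdd h2
  linarith

/-- On the tangent hyperplane, the excess of the gauge over `1` is asymptotic to the depth of the
boundary divided by the distance of the hyperplane from the origin. -/
theorem isEquivalent_gauge_sub_one_localGraph (hc : Convex ℝ K) (h0 : K ∈ 𝓝 0) (hcl : IsClosed K)
    (h : DifferentiableAt ℝ (gauge K) z) (hz : gauge K z = 1) :
    (fun y : (Submodule.span ℝ {outerUnitNormal K z})ᗮ =>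
      gauge K (z + (y : EuclideanSpace ℝ (Fin n))) - 1) ~[𝓝 0]
      fun y => ⟪z, outerUnitNormal K z⟫⁻¹ * localGraph K z y := by
  have hN1 := norm_outerUnitNormal hc h0 hcl h hz
  have hh := inner_outerUnitNormal_pos hc h0 hcl h hz
  have hst := ((convexOn_gauge hc h0).hasStrictFDerivAt h.hasFDerivAt).isLittleO
  have ht1 := tendsto_add_coe_nhds z (outerUnitNormal K z)
  have ht2 : Tendsto (fun y : (Submodule.span ℝ {outerUnitNormal K z})ᗮ =>
      z + (y : EuclideanSpace ℝ (Fin n)) - localGraph K z y • outerUnitNormal K z) (𝓝 0) (𝓝 z) := by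
    have := ht1.sub ((tendsto_localGraph hc h0 hcl h hz).smul_const (outerUnitNormal K z))
    simpa using this
  have h1 := hst.comp_tendsto (ht1.prodMk_nhds ht2)
  rw [IsEquivalent, isLittleO_const_mul_right_iff (inv_ne_zero hh.ne')]
  refine (h1.congr' ?_ (EventuallyEq.refl _ _)).trans_isBigO ?_
  · filter_upwards [eventually_gauge_localGraph hc h0 hcl h hz] with y hy
    simp only [Function.comp, Pi.sub_apply, hy, sub_sub_cancel, real_inner_smul_left,
      fderiv_gauge_apply hc h0 hcl h hz, real_inner_self_eq_norm_sq, hN1]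
    ring
  · refine IsBigO.of_bound 1 (Eventually.of_forall fun y => ?_)
    simp [norm_smul, hN1]

theorem isEquivalent_gauge_sq_localGraph (hc : Convex ℝ K) (h0 : K ∈ 𝓝 0) (hcl : IsClosed K)
    (h : DifferentiableAt ℝ (gauge K) z) (hz : gauge K z = 1) :
    (fun y : (Submodule.span ℝ {outerUnitNormal K z})ᗮ =>
      gauge K (z + (y : EuclideanSpace ℝ (Fin n))) ^ 2 / 2 - 1 / 2) ~[𝓝 0]
      fun y => ⟪z, outerUnitNormal K z⟫⁻¹ * localGraph K z y := by
  refine IsEquivalent.trans ?_ (isEquivalent_gauge_sub_one_localGraph hc h0 hcl h hz)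
  have ht : Tendsto (fun y : (Submodule.span ℝ {outerUnitNormal K z})ᗮ =>
      (gauge K (z + (y : EuclideanSpace ℝ (Fin n))) - 1) / 2) (𝓝 0) (𝓝 0) := by
    have := ((((continuous_gauge hc h0).tendsto z).comp
      (tendsto_add_coe_nhds z (outerUnitNormal K z))).sub_const 1).div_const 2
    simpa [hz, Function.comp_def] using this
  have h1 := (isLittleO_one_iff ℝ).2 ht |>.mul_isBigO
    (isBigO_refl (fun y : (Submodule.span ℝ {outerUnitNormal K z})ᗮ =>
      gauge K (z + (y : EuclideanSpace ℝ (Fin n))) - 1) (𝓝 0))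
  refine h1.congr (fun y => ?_) (fun y => by ring)
  simp only [Pi.sub_apply]
  ring

theorem gradient_localGraph_zero (hc : Convex ℝ K) (h0 : K ∈ 𝓝 0) (hcl : IsClosed K)
    (h : DifferentiableAt ℝ (gauge K) z) (hz : gauge K z = 1) :
    gradient (localGraph K z) 0 = 0 := by
  have hmin : IsLocalMin (localGraph K z) 0 := Eventually.of_forall fun y => by
    rw [localGraph_zero hc h0 hcl h hz]
    exact localGraph_nonneg hc h0 hcl h hz y
  rw [gradient, hmin.fderiv_eq_zero, map_zero]

/-- A second order expansion of the local graph is one of `(gauge K) ^ 2 / 2` on the tangent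
hyperplane, rescaled by the distance of that hyperplane from the origin. -/
theorem hasGeneralizedHessianAt_localGraph_iff (hc : Convex ℝ K) (h0 : K ∈ 𝓝 0) (hcl : IsClosed K)
    (h : DifferentiableAt ℝ (gauge K) z) (hz : gauge K z = 1)
    (B : (Submodule.span ℝ {outerUnitNormal K z})ᗮ →ₗ[ℝ]
      (Submodule.span ℝ {outerUnitNormal K z})ᗮ) :
    HasGeneralizedHessianAt (localGraph K z) B 0 ↔ B.IsSymmetric ∧
      (fun y : (Submodule.span ℝ {outerUnitNormal K z})ᗮ =>
        gauge K (z + (y : EuclideanSpace ℝ (Fin n))) ^ 2 / 2 - 1 / 2 -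
          (1 / 2) * ⟪(⟪z, outerUnitNormal K z⟫⁻¹ • B) y, y⟫) =o[𝓝 0] fun y => ‖y‖ ^ 2 := by
  have hh := inner_outerUnitNormal_pos hc h0 hcl h hz
  have heq := isEquivalent_gauge_sq_localGraph hc h0 hcl h hz
  have hq := (isBigO_inner_map_self (⟪z, outerUnitNormal K z⟫⁻¹ • B)).const_mul_left (1 / 2)
  rw [HasGeneralizedHessianAt]
  refine and_congr_right fun _ => ?_
  have h1 : (fun y : (Submodule.span ℝ {outerUnitNormal K z})ᗮ => localGraph K z (0 + y) -
      localGraph K z 0 - ⟪gradient (localGraph K z) 0, y⟫ - 1 / 2 * ⟪B y, y⟫) =o[𝓝 0]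
        (fun y => ‖y‖ ^ 2) ↔
      (fun y => ⟪z, outerUnitNormal K z⟫⁻¹ * localGraph K z y -
        (1 / 2) * ⟪(⟪z, outerUnitNormal K z⟫⁻¹ • B) y, y⟫) =o[𝓝 0] fun y => ‖y‖ ^ 2 := by
    rw [← isLittleO_const_mul_left_iff (inv_ne_zero hh.ne')]
    refine isLittleO_congr (Eventually.of_forall fun y => ?_) (EventuallyEq.refl _ _)
    simp only [gradient_localGraph_zero hc h0 hcl h hz, localGraph_zero hc h0 hcl h hz, zero_add,
      inner_zero_left, sub_zero, LinearMap.smul_apply, real_inner_smul_left]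
    ring
  rw [h1]
  exact ⟨fun h => isLittleO_sub_of_isEquivalent heq.symm hq h,
    fun h => isLittleO_sub_of_isEquivalent heq hq h⟩

end LocalGraph

/-! ### Gauss curvature and the Hessian of the squared gauge -/

section Curvature

variable {n : ℕ} {K : Set (EuclideanSpace ℝ (Fin n))} {z : EuclideanSpace ℝ (Fin n)}

theorem gauge_sq_smul {V : Type*} [NormedAddCommGroup V] [NormedSpace ℝ V] (K : Set V) (r : ℝ)
    (hr : 0 < r) (x : V) : gauge K (r • x) ^ 2 / 2 = r ^ 2 * (gauge K x ^ 2 / 2) := by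
  rw [gauge_smul_nonneg hr.le]; ring

theorem inner_gradient_gauge_sq (hc : Convex ℝ K) (h0 : K ∈ 𝓝 0) (hcl : IsClosed K)
    (h : DifferentiableAt ℝ (gauge K) z) (hz : gauge K z = 1) (v : EuclideanSpace ℝ (Fin n)) :
    ⟪gradient (fun x => gauge K x ^ 2 / 2) z, v⟫ =
      ⟪v, outerUnitNormal K z⟫ / ⟪z, outerUnitNormal K z⟫ := by
  have h1 : HasFDerivAt (fun x => gauge K x ^ 2 / 2) (fderiv ℝ (gauge K) z) z := by
    have := (h.hasFDerivAt.pow 2).const_mul (1 / 2)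
    convert! this using 1
    · ext x; ring
    · ext v; simp [hz]
  rw [inner_gradient_eq_fderiv, h1.fderiv, fderiv_gauge_apply hc h0 hcl h hz]

/-- The expansion of `(gauge K) ^ 2 / 2` at a boundary point restricts to the tangent hyperplane. -/
theorem exists_hasGeneralizedHessianAt_localGraph (hc : Convex ℝ K) (h0 : K ∈ 𝓝 0)
    (hcl : IsClosed K) (h : DifferentiableAt ℝ (gauge K) z) (hz : gauge K z = 1)
    {A : EuclideanSpace ℝ (Fin n) →ₗ[ℝ] EuclideanSpace ℝ (Fin n)}
    (hA : HasGeneralizedHessianAt (fun x => gauge K x ^ 2 / 2) A z) :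
    ∃ B, HasGeneralizedHessianAt (localGraph K z) B 0 := by
  have hh := inner_outerUnitNormal_pos hc h0 hcl h hz
  set W := (Submodule.span ℝ {outerUnitNormal K z})ᗮ with hW
  -- the compression of `A` to the tangent hyperplane
  set C : W →ₗ[ℝ] W := W.orthogonalProjectionOnto.toLinearMap ∘ₗ A ∘ₗ W.subtype with hC
  have hCi : ∀ v w : W, ⟪C v, w⟫ = ⟪A v, (w : EuclideanSpace ℝ (Fin n))⟫ := fun v w =>
    Submodule.inner_orthogonalProjectionOnto_eq_of_mem_right w (A v)
  have hCs : C.IsSymmetric := fun v w => by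
    rw [hCi, hA.1, real_inner_comm (C w), hCi, real_inner_comm]
  refine ⟨⟪z, outerUnitNormal K z⟫ • C,
    (hasGeneralizedHessianAt_localGraph_iff hc h0 hcl h hz _).2 ⟨hCs.smul (by simp), ?_⟩⟩
  rw [inv_smul_smul₀ hh.ne']
  have ht : Tendsto (fun y : W => (y : EuclideanSpace ℝ (Fin n))) (𝓝 0) (𝓝 0) := by
    have : Continuous fun y : W => (y : EuclideanSpace ℝ (Fin n)) := by fun_prop
    simpa using this.tendsto 0
  refine (hA.2.comp_tendsto ht).congr (fun y => ?_) (fun y => rfl)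
  have hy : ⟪(y : EuclideanSpace ℝ (Fin n)), outerUnitNormal K z⟫ = 0 :=
    Submodule.mem_orthogonal_singleton_iff_inner_left.1 y.2
  simp only [Function.comp, inner_gradient_gauge_sq hc h0 hcl h hz, hy, hz, hCi]
  ring

/-- For a function homogeneous of degree `2`, a second order expansion on a hyperplane through `z`
extends to the whole space. -/
theorem hasGeneralizedHessianAt_obliqueExtension {V : Type*} [NormedAddCommGroup V]
    [InnerProductSpace ℝ V] [FiniteDimensional ℝ V] {f : V → ℝ} {N z : V}
    (hf : ∀ r : ℝ, 0 < r → ∀ x, f (r • x) = r ^ 2 * f x) (hN : ‖N‖ = 1) (hz : 0 < ⟪z, N⟫)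
    (hgrad : ∀ v, ⟪gradient f z, v⟫ = ⟪v, N⟫ / ⟪z, N⟫) (hfz : f z = 1 / 2)
    {B : (Submodule.span ℝ {N})ᗮ →ₗ[ℝ] (Submodule.span ℝ {N})ᗮ} (hBs : B.IsSymmetric)
    (hBo : (fun y : (Submodule.span ℝ {N})ᗮ => f (z + (y : V)) - 1 / 2 - (1 / 2) * ⟪B y, y⟫)
      =o[𝓝 0] fun y => ‖y‖ ^ 2) :
    HasGeneralizedHessianAt f (obliqueExtension N z hN B) z := by
  refine ⟨isSymmetric_obliqueExtension hN hz.ne' hBs, ?_⟩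
  set Lm : V →L[ℝ] (Submodule.span ℝ {N})ᗮ :=
    (Submodule.span ℝ {N})ᗮ.orthogonalProjectionOnto ∘L
      LinearMap.toContinuousLinearMap (shearToNormal N z) with hLm
  have hLc : ∀ v, (Lm v : V) = v - (⟪v, N⟫ / ⟪z, N⟫) • z :=
    coe_orthogonalProjectionOnto_shearToNormal hN hz.ne'
  set a : V → ℝ := fun v => ⟪v, N⟫ / ⟪z, N⟫ with ha
  have hac : Continuous a := by
    have : Continuous fun v : V => ⟪v, N⟫ := by fun_prop
    exact this.div_const _
  have ha0 : a 0 = 0 := by simp [ha]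
  have hev : ∀ᶠ v in 𝓝 0, 0 < 1 + a v :=
    (continuous_const.add hac).continuousAt.eventually_const_lt (by simp [ha0])
  have ht : Tendsto (fun v => (1 + a v)⁻¹ • Lm v) (𝓝 0) (𝓝 0) := by
    have h1 : ContinuousAt (fun v => (1 + a v)⁻¹ • Lm v) 0 :=
      (ContinuousAt.inv₀ (continuous_const.add hac).continuousAt (by simp [ha0])).smul
        Lm.continuous.continuousAt
    have h2 := h1.tendsto
    simpa using h2
  have h1 := (isBigO_refl (fun v => (1 + a v) ^ 2) (𝓝 0)).mul_isLittleO (hBo.comp_tendsto ht)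
  have h2 : (fun v => (1 + a v) ^ 2 *
      ((fun y : (Submodule.span ℝ {N})ᗮ => ‖y‖ ^ 2) ∘ fun v => (1 + a v)⁻¹ • Lm v) v) =O[𝓝 0]
        fun v => ‖v‖ ^ 2 := by
    refine IsBigO.of_bound (‖Lm‖ ^ 2) ?_
    filter_upwards [hev] with v hv
    have e : (1 + a v) ^ 2 * ((fun y : (Submodule.span ℝ {N})ᗮ => ‖y‖ ^ 2) ∘
        fun v => (1 + a v)⁻¹ • Lm v) v = ‖Lm v‖ ^ 2 := by
      simp only [Function.comp, norm_smul, norm_inv, Real.norm_of_nonneg hv.le]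
      field_simp
    rw [e, norm_pow, norm_norm, norm_pow, norm_norm, ← mul_pow]
    exact pow_le_pow_left₀ (norm_nonneg _) (Lm.le_opNorm v) 2
  refine (h1.trans_isBigO h2).congr' ?_ (EventuallyEq.refl _ _)
  filter_upwards [hev] with v hv
  -- homogeneity moves `z + v` back to the hyperplane through `z` parallel to `Nᗮ`
  have e1 : z + v = (1 + a v) • (z + (((1 + a v)⁻¹ • Lm v : (Submodule.span ℝ {N})ᗮ) : V)) := by
    rw [Submodule.coe_smul, smul_add, smul_inv_smul₀ hv.ne', hLc]
    simp only [ha]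
    module
  have e2 := inner_obliqueExtension hN hz.ne' B v v
  have e3 : (Submodule.span ℝ {N})ᗮ.orthogonalProjectionOnto (shearToNormal N z v) = Lm v := rfl
  have e4 : f (z + v) =
      (1 + a v) ^ 2 * f (z + (((1 + a v)⁻¹ • Lm v : (Submodule.span ℝ {N})ᗮ) : V)) := by
    conv_lhs => rw [e1]
    exact hf _ hv _
  rw [e2, e3, e4, hgrad, hfz]
  simp only [Function.comp, map_smul, real_inner_smul_left, real_inner_smul_right]
  have e5 : ⟪v, N⟫ / ⟪z, N⟫ = a v := rfl
  rw [e5]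
  field_simp
  ring

/-- The expansion of the local graph determines the one of `(gauge K) ^ 2 / 2` in all directions. -/
theorem hasGeneralizedHessianAt_gauge_sq (hc : Convex ℝ K) (h0 : K ∈ 𝓝 0) (hcl : IsClosed K)
    (h : DifferentiableAt ℝ (gauge K) z) (hz : gauge K z = 1)
    {B : (Submodule.span ℝ {outerUnitNormal K z})ᗮ →ₗ[ℝ]
      (Submodule.span ℝ {outerUnitNormal K z})ᗮ}
    (hB : HasGeneralizedHessianAt (localGraph K z) B 0) :
    HasGeneralizedHessianAt (fun x => gauge K x ^ 2 / 2)
      (obliqueExtension (outerUnitNormal K z) z (norm_outerUnitNormal hc h0 hcl h hz)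
        (⟪z, outerUnitNormal K z⟫⁻¹ • B)) z := by
  obtain ⟨hBs, hBo⟩ := (hasGeneralizedHessianAt_localGraph_iff hc h0 hcl h hz B).1 hB
  exact hasGeneralizedHessianAt_obliqueExtension (gauge_sq_smul K)
    (norm_outerUnitNormal hc h0 hcl h hz) (inner_outerUnitNormal_pos hc h0 hcl h hz)
    (inner_gradient_gauge_sq hc h0 hcl h hz) (by simp [hz]) (hBs.smul (by simp)) hBo

theorem finrank_orthogonal_span_singleton_of_norm_eq_one {N : EuclideanSpace ℝ (Fin n)}
    (hN : ‖N‖ = 1) : Module.finrank ℝ (Submodule.span ℝ {N})ᗮ = n - 1 := by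
  have h1 := (Submodule.span ℝ {N}).finrank_add_finrank_orthogonal
  rw [finrank_span_singleton (by rintro rfl; simp at hN), finrank_euclideanSpace_fin] at h1
  omega

/-- The Gauss curvature at `z` is, up to a power of the distance of the tangent hyperplane from the
origin, the determinant of the generalized Hessian of `(gauge K) ^ 2 / 2`. If one of the two
Hessians does not exist, neither does the other, and both sides vanish. -/
theorem gaussCurvature_eq (hn : 1 ≤ n) (hc : Convex ℝ K) (h0 : K ∈ 𝓝 0) (hcl : IsClosed K)
    (h : DifferentiableAt ℝ (gauge K) z) (hz : gauge K z = 1) :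
    gaussCurvature K z = ⟪z, outerUnitNormal K z⟫ ^ (n + 1) *
      LinearMap.det (generalizedHessian (fun x => gauge K x ^ 2 / 2) z) := by
  have hN1 := norm_outerUnitNormal hc h0 hcl h hz
  have hh := inner_outerUnitNormal_pos hc h0 hcl h hz
  have hfr := finrank_orthogonal_span_singleton_of_norm_eq_one hN1
  rw [gaussCurvature, if_pos (existsUnique_isOuterUnitNormal hc h0 hcl h hz)]
  by_cases hex : ∃ B, HasGeneralizedHessianAt (localGraph K z) B 0
  · have hB := hasGeneralizedHessianAt_generalizedHessian hex
    rw [(hasGeneralizedHessianAt_gauge_sq hc h0 hcl h hz hB).generalizedHessian_eq,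
      det_obliqueExtension _ hh.ne', LinearMap.det_smul, hfr]
    obtain ⟨m, rfl⟩ : ∃ m, n = m + 1 := ⟨n - 1, by omega⟩
    rw [Nat.add_sub_cancel, inv_pow, inv_pow]
    field_simp
    ring
  · have hex' : ¬ ∃ A, HasGeneralizedHessianAt (fun x => gauge K x ^ 2 / 2) A z := by
      rintro ⟨A, hA⟩
      exact hex (exists_hasGeneralizedHessianAt_localGraph hc h0 hcl h hz hA)
    rw [generalizedHessian_eq_zero hex, generalizedHessian_eq_zero hex', LinearMap.det_zero,
      LinearMap.det_zero, hfr, finrank_euclideanSpace_fin, zero_pow (show n ≠ 0 by omega),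
      mul_zero, zero_pow]
    -- in dimension one every function on the trivial tangent space has a Hessian
    intro hn1
    refine hex ⟨0, (hasGeneralizedHessianAt_localGraph_iff hc h0 hcl h hz 0).2
      ⟨LinearMap.IsSymmetric.zero, ?_⟩⟩
    have : Subsingleton (Submodule.span ℝ {outerUnitNormal K z})ᗮ :=
      Module.finrank_zero_iff.1 (hfr.trans hn1)
    refine (isLittleO_zero _ _).congr_left fun y => ?_
    rw [Subsingleton.elim y 0]
    simp [hz]

theorem isPositive_generalizedHessian_gauge_sq (hc : Convex ℝ K) (h0 : K ∈ 𝓝 0)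
    (x : EuclideanSpace ℝ (Fin n)) :
    (generalizedHessian (fun x => gauge K x ^ 2 / 2) x).IsPositive := by
  by_cases h : ∃ A, HasGeneralizedHessianAt (fun x => gauge K x ^ 2 / 2) A x
  · exact (convexOn_gauge_sq hc h0).isPositive_of_hasGeneralizedHessianAt
      (hasGeneralizedHessianAt_generalizedHessian h)
  · rw [generalizedHessian_eq_zero h]; exact LinearMap.isPositive_zero

/-- For `p = n / (n + 1)` the exponents of the curvature and of the support distance are
`1 / (n + 2)` and `-1 / (n + 2)`. Together with the `n + 1` powers of the distance contained in the
curvature, the distance occurs to the power `1`, which is the density of the cone measure. -/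
theorem lpAffineSurfaceDensity_eq (hn : 1 ≤ n) (hc : Convex ℝ K) (h0 : K ∈ 𝓝 0) (hcl : IsClosed K)
    (h : DifferentiableAt ℝ (gauge K) z) (hz : gauge K z = 1) :
    lpAffineSurfaceDensity ((n : ℝ) / (n + 1)) K z = ‖fderiv ℝ (gauge K) z‖⁻¹ *
      LinearMap.det (generalizedHessian (fun x => gauge K x ^ 2 / 2) z) ^ (1 / ((n : ℝ) + 2)) := by
  have hh := inner_outerUnitNormal_pos hc h0 hcl h hz
  have hn0 : (0 : ℝ) < n := by exact_mod_cast hn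
  have hexp1 : (n : ℝ) / (n + 1) / (n + (n : ℝ) / (n + 1)) = 1 / ((n : ℝ) + 2) := by
    field_simp; ring
  have hexp2 : (n : ℝ) * ((n : ℝ) / (n + 1) - 1) / (n + (n : ℝ) / (n + 1)) =
      -(1 / ((n : ℝ) + 2)) := by
    field_simp; ring
  have hdet := (isPositive_generalizedHessian_gauge_sq hc h0 z).det_nonneg'
  rw [lpAffineSurfaceDensity, hexp1, hexp2, gaussCurvature_eq hn hc h0 hcl h hz,
    Real.mul_rpow (by positivity) hdet, Real.rpow_neg hh.le, div_inv_eq_mul, mul_right_comm,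
    ← Real.mul_rpow (by positivity) hh.le, ← pow_succ, ← Real.rpow_natCast, ← Real.rpow_mul hh.le]
  have e : ((n + 1 + 1 : ℕ) : ℝ) * (1 / ((n : ℝ) + 2)) = 1 := by
    push_cast; field_simp; ring
  rw [e, Real.rpow_one, inner_outerUnitNormal hc h0 hcl h hz, norm_gradient_eq]

end Curvature

/-! ### Affine surface areas -/

open scoped ENNReal in
/-- The integral formula for a compact convex neighbourhood `K` of the origin. -/
theorem integrable_and_affineSurfaceArea_gauge_sq_eq {n : ℕ} (hn : 1 ≤ n)
    {K : Set (EuclideanSpace ℝ (Fin n))} (hc : Convex ℝ K) (hcomp : IsCompact K) (h0 : K ∈ 𝓝 0) :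
    Integrable (affineSurfaceDensity fun x => gauge K x ^ 2 / 2) ∧
    Integrable (lpAffineSurfaceDensity ((n : ℝ) / (n + 1)) K) (surfaceAreaMeasure K) ∧
    affineSurfaceArea (fun x => gauge K x ^ 2 / 2) = (2 * Real.pi) ^ ((n : ℝ) / 2) /
      (n * volume.real (Metric.closedBall (0 : EuclideanSpace ℝ (Fin n)) 1)) *
        lpAffineSurfaceArea ((n : ℝ) / (n + 1)) K := by
  have hb := hcomp.isBounded
  have hcl := hcomp.isClosed
  have hgc := continuous_gauge hc h0
  set ψ : EuclideanSpace ℝ (Fin n) → ℝ := fun x => gauge K x ^ 2 / 2 with hψ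
  have hψc : Continuous ψ := by fun_prop
  have hψconv : ConvexOn ℝ univ ψ := convexOn_gauge_sq hc h0
  set G : EuclideanSpace ℝ (Fin n) → ℝ := fun x =>
    LinearMap.det (generalizedHessian ψ x) ^ (1 / ((n : ℝ) + 2)) with hG
  have hGm : Measurable G := (measurable_det_generalizedHessian hψc).pow_const _
  have hG0 : ∀ x, 0 ≤ G x := fun x =>
    Real.rpow_nonneg (isPositive_generalizedHessian_gauge_sq hc h0 x).det_nonneg' _
  have hGr : ∀ r : ℝ, 0 < r → ∀ x, ENNReal.ofReal (G (r • x)) = ENNReal.ofReal (G x) := by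
    intro r hr x
    simp only [hG]
    rw [generalizedHessian_smul (gauge_sq_smul K) hr]
  set ρ : EuclideanSpace ℝ (Fin n) → ℝ := fun x => ‖fderiv ℝ (gauge K) x‖⁻¹ with hρ
  have hρm : Measurable ρ := measurable_norm_fderiv_gauge_inv K
  have hρ0 : ∀ x, 0 ≤ ρ x := fun x => inv_nonneg.2 (norm_nonneg _)
  -- the integral over the body is finite
  have hfin1 : ∫⁻ x in {x | gauge K x < 1}, ENNReal.ofReal (G x) < ∞ := by
    obtain ⟨R, hR⟩ := hb.subset_ball 0
    obtain ⟨L, hL⟩ := (hψconv.subset (subset_univ (Metric.ball 0 (R + 5)))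
      (convex_ball _ _)).exists_lipschitzOnWith_of_isBounded (r' := R + 4) (by linarith)
      ((isCompact_closedBall (0 : EuclideanSpace ℝ (Fin n)) (R + 5)).image hψc |>.isBounded.subset
        (image_mono Metric.ball_subset_closedBall))
    refine lt_of_le_of_lt (lintegral_mono_set fun x hx => hR ?_)
      (lintegral_det_generalizedHessian_lt_top hψconv hψc R hL)
    exact interior_subset ((gauge_lt_one_iff_mem_interior hc h0).1 hx)
  have hdens : ∀ x, affineSurfaceDensity ψ x = G x * Real.exp (-(gauge K x ^ 2 / 2)) := fun x => rfl
  have hdens0 : ∀ x, 0 ≤ affineSurfaceDensity ψ x := fun x => by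
    rw [hdens]; exact mul_nonneg (hG0 x) (Real.exp_pos _).le
  have hdensm : Measurable (affineSurfaceDensity ψ) :=
    hGm.mul (Real.measurable_exp.comp hψc.measurable.neg)
  have hlin : ∫⁻ x, ENNReal.ofReal (affineSurfaceDensity ψ x) =
      ∫⁻ x, ENNReal.ofReal (G x) * ENNReal.ofReal (Real.exp (-(gauge K x ^ 2 / 2))) := by
    refine lintegral_congr fun x => ?_
    rw [hdens, ENNReal.ofReal_mul (hG0 x)]
  have hae : lpAffineSurfaceDensity ((n : ℝ) / (n + 1)) K =ᵐ[surfaceAreaMeasure K]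
      fun z => ρ z * G z := by
    rw [surfaceAreaMeasure, frontier_eq_gauge_eq_one hc h0]
    have h1 := hausdorffMeasure_not_differentiableAt_gauge hn hc h0 hb
    rw [EventuallyEq, ae_restrict_iff' (measurableSet_gauge_eq_one hc h0), ae_iff]
    refine measure_mono_null (fun z hz => ?_) h1
    simp only [mem_ofPred_eq, Classical.not_imp] at hz
    exact ⟨hz.1, fun hd => hz.2 (lpAffineSurfaceDensity_eq hn hc h0 hcl hd hz.1)⟩
  have hlin2 : ∫⁻ z, ENNReal.ofReal (ρ z) * ENNReal.ofReal (G z) ∂(surfaceAreaMeasure K) =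
      n * ∫⁻ x in {x | gauge K x < 1}, ENNReal.ofReal (G x) := by
    rw [← lintegral_coneMeasure hc h0 hb hGm.ennreal_ofReal hGr,
      coneMeasure_eq_withDensity hn hc h0 hb, lintegral_withDensity_eq_lintegral_mul _
      (measurable_norm_fderiv_gauge_inv K).ennreal_ofReal hGm.ennreal_ofReal]
    rfl
  have hpolar := lintegral_mul_exp_eq_lintegral_surfaceAreaMeasure hn hc h0 hb
    hGm.ennreal_ofReal hGr
  rw [← hlin] at hpolar
  have hprod : ∀ z, ENNReal.ofReal (ρ z) * ENNReal.ofReal (G z) = ENNReal.ofReal (ρ z * G z) :=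
    fun z => (ENNReal.ofReal_mul (hρ0 z)).symm
  have hfin2 : ∫⁻ z, ENNReal.ofReal (ρ z * G z) ∂(surfaceAreaMeasure K) < ∞ := by
    simp_rw [← hprod]
    rw [hlin2]
    exact ENNReal.mul_lt_top (ENNReal.natCast_lt_top n) hfin1
  set vB := volume.real (Metric.closedBall (0 : EuclideanSpace ℝ (Fin n)) 1) with hvB
  have hn0 : (0 : ℝ) < n := by exact_mod_cast hn
  have hvB0 : 0 < vB := ENNReal.toReal_pos (Metric.measure_closedBall_pos _ _ one_pos).ne'
    measure_closedBall_lt_top.ne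
  have hcoef : (n : ℝ≥0∞) * volume (Metric.closedBall (0 : EuclideanSpace ℝ (Fin n)) 1) =
      ENNReal.ofReal (n * vB) := by
    rw [ENNReal.ofReal_mul hn0.le, ENNReal.ofReal_natCast, hvB, measureReal_def,
      ENNReal.ofReal_toReal measure_closedBall_lt_top.ne]
  have hpolar' : ENNReal.ofReal (n * vB) * ∫⁻ x, ENNReal.ofReal (affineSurfaceDensity ψ x) =
      ENNReal.ofReal ((2 * Real.pi) ^ ((n : ℝ) / 2)) *
        ∫⁻ z, ENNReal.ofReal (ρ z * G z) ∂(surfaceAreaMeasure K) := by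
    simp_rw [← hprod]
    rw [← hcoef]
    exact hpolar
  have hfin : ∫⁻ x, ENNReal.ofReal (affineSurfaceDensity ψ x) < ∞ := by
    refine lt_top_iff_ne_top.2 fun htop => ?_
    rw [htop, ENNReal.mul_top (ENNReal.ofReal_pos.2 (by positivity)).ne'] at hpolar'
    exact (ENNReal.mul_lt_top ENNReal.ofReal_lt_top hfin2).ne hpolar'.symm
  have hi1 : Integrable (affineSurfaceDensity ψ) := by
    refine ⟨hdensm.aestronglyMeasurable, ?_⟩
    rwa [hasFiniteIntegral_iff_ofReal (Eventually.of_forall hdens0)]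
  have hi2' : Integrable (fun z => ρ z * G z) (surfaceAreaMeasure K) := by
    refine ⟨(hρm.mul hGm).aestronglyMeasurable, ?_⟩
    rwa [hasFiniteIntegral_iff_ofReal (Eventually.of_forall fun z => mul_nonneg (hρ0 z) (hG0 z))]
  refine ⟨hi1, hi2'.congr hae.symm, ?_⟩
  rw [affineSurfaceArea, lpAffineSurfaceArea, integral_congr_ae hae,
    integral_eq_lintegral_of_nonneg_ae (Eventually.of_forall hdens0) hdensm.aestronglyMeasurable,
    integral_eq_lintegral_of_nonneg_ae (Eventually.of_forall fun z => mul_nonneg (hρ0 z) (hG0 z))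
      (hρm.mul hGm).aestronglyMeasurable]
  have hreal := congrArg ENNReal.toReal hpolar'
  rw [ENNReal.toReal_mul, ENNReal.toReal_mul, ENNReal.toReal_ofReal (by positivity),
    ENNReal.toReal_ofReal (by positivity)] at hreal
  rw [div_mul_eq_mul_div, eq_div_iff (by positivity), ← hreal, mul_comm]

theorem mainTheorem4 (n : ℕ) (hn : 1 ≤ n) (K : ConvexBody (EuclideanSpace ℝ (Fin n)))
    (hK : (0 : EuclideanSpace ℝ (Fin n)) ∈ interior (K : Set (EuclideanSpace ℝ (Fin n)))) :
    Integrable (affineSurfaceDensity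
        fun x => gauge (K : Set (EuclideanSpace ℝ (Fin n))) x ^ 2 / 2) ∧
    Integrable (lpAffineSurfaceDensity ((n : ℝ) / (n + 1)) (K : Set (EuclideanSpace ℝ (Fin n))))
      (surfaceAreaMeasure (K : Set (EuclideanSpace ℝ (Fin n)))) ∧
    affineSurfaceArea (fun x => gauge (K : Set (EuclideanSpace ℝ (Fin n))) x ^ 2 / 2) =
      (2 * Real.pi) ^ ((n : ℝ) / 2) /
          (n * volume.real (Metric.closedBall (0 : EuclideanSpace ℝ (Fin n)) 1)) *
        lpAffineSurfaceArea ((n : ℝ) / (n + 1)) (K : Set (EuclideanSpace ℝ (Fin n))) :=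
  integrable_and_affineSurfaceArea_gauge_sq_eq hn K.convex K.isCompact
    (mem_interior_iff_mem_nhds.1 hK)
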